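/- Let $k$ be an algebraically closed field of characteristic $0$ and let $n\ge 5$. Let $Q=\widetilde{D_{n-1}}$ be the quiver with vertices $1,\dots,n$ and arrows $\alpha_1\colon 1\to 3$, $\alpha_2\colon 2\to 3$, $\alpha_i\colon i\to i+1$ for $3\le i\le n-3$, $\alpha_{n-1}\colon n-2\to n-1$ and $\alpha_n\colon n-2\to n$. Let $$A=\Pi(Q)=k\bar Q\Big/\Big(\sum_{\alpha\in Q_1}(\alpha\alpha^\ast-\alpha^\ast\alpha)\Big)$$ be its preprojective algebra, where $\bar Q$ is the double of $Q$ (for each arrow $\alpha\colon i\to j$ an arrow $\alpha^\ast\colon j\to i$ is added) and paths are composed from left to right. Grade $A$ by path length, $A=\bigoplus_{s\ge 0}A_s$, and let $e_1,\dots,e_n$ be the idempotents given by the trivial paths. Let $g$ be a graded $k$-algebra automorphism of $A$ with $g(e_i)=e_i$ for all $i$ and $g(\alpha_i)=c_i\alpha_i$, $g(\alpha_i^\ast)=t_i\alpha_i^\ast$ for $1\le i\le n-3$ and $i=n-1,n$, where $c_i,t_i\in k$. Define the vector traces $\underline{\operatorname{Tr}}(g,t),\overline{\operatorname{Tr}}(g,t)\in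 k[[t]]^n$ by $$[\underline{\operatorname{Tr}}(g,t)]_j=\sum_{s\ge 0}\operatorname{tr}(g|_{e_jA_s})\,t^s,\qquad [\overline{\operatorname{Tr}}(g,t)]_j=\sum_{s\ge 0}\operatorname{tr}(g|_{A_se_j})\,t^s .$$ Let $M(c_i,t_i,t)$ be the $n\times n$ matrix over $k[t]$ all of whose diagonal entries are $1+c_1t_1t^2$, and whose off-diagonal entries are as follows: for each arrow $\alpha_i\colon a\to b$ of $Q$, the entry in position $(a,b)$ is $-c_it$ and the entry in position $(b,a)$ is $-t_it$; all other off-diagonal entries are $0$. That is, $$M(c_i,t_i,t)=\begin{pmatrix} 1+c_1t_1t^2&0&-c_1t&&&&\\ 0&1+c_1t_1t^2&-c_2t&&&&\\ -t_1t&-t_2t&1+c_1t_1t^2&-c_3t&&&\\ &&\ddots&\ddots&\ddots&&\\ &&&-t_{n-3}t&1+c_1t_1t^2&-c_{n-1}t&-c_nt\\ &&&&-t_{n-1}t&1+c_1t_1t^2&0\\ &&&&-t_nt&0&1+c_1t_1t^2 \end{pmatrix},$$ where for $n=5$ the third and the $(n-2)$-nd row coincide, being $(-t_1t,\,-t_2t,\,1+c_1t_1t^2,\,-c_4t,\,-c_5t)$.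 Let $M(t_i,c_i,t)$ be the matrix obtained by exchanging the roles of the $c_i$ and the $t_i$. Then all the spaces $e_jA_s$ and $A_se_j$ are finite-dimensional, $M(c_i,t_i,t)$ and $M(t_i,c_i,t)$ are invertible over $k[[t]]$, and $$\underline{\operatorname{Tr}}(g,t)=M(c_i,t_i,t)^{-1}\begin{pmatrix}1\\ \vdots\\ 1\end{pmatrix},\qquad \overline{\operatorname{Tr}}(g,t)=M(t_i,c_i,t)^{-1}\begin{pmatrix}1\\ \vdots\\ 1\end{pmatrix},$$ where $M(t_i,c_i,t)=M(c_i,t_i,t)^T$. -/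

import Mathlib

open scoped PowerSeries

noncomputable section

/-! Path algebras -/

/-- The path algebra `k Q` of a quiver `Q` with vertex set `V`: the free `k`-module on the set of
all paths (of length `≥ 0`) of `Q`. -/
def PathAlgebra (k V : Type*) [CommRing k] [Quiver V] : Type _ :=
  (Σ a b : V, Quiver.Path a b) →₀ k

namespace PathAlgebra

section Basic

variable (k : Type*) {V : Type*} [CommRing k] [Quiver V]

instance : AddCommGroup (PathAlgebra k V) :=
  inferInstanceAs (AddCommGroup ((Σ a b : V, Quiver.Path a b) →₀ k))

instance : Module k (PathAlgebra k V) :=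
  inferInstanceAs (Module k ((Σ a b : V, Quiver.Path a b) →₀ k))

/-- The basis element of the path algebra given by a path. -/
def ofPath {a b : V} (p : Quiver.Path a b) : PathAlgebra k V :=
  (Finsupp.single ⟨a, b, p⟩ 1 : (Σ a b : V, Quiver.Path a b) →₀ k)

/-- The trivial path at the vertex `a`. -/
def idem (a : V) : PathAlgebra k V := ofPath k (Quiver.Path.nil : Quiver.Path a a)

open Classical in
/-- The product of two paths: concatenation if the target of the first one is the source of the
second one, and zero otherwise. -/
def pathMul (p q : Σ a b : V, Quiver.Path a b) : PathAlgebra k V :=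
  if h : p.2.1 = q.1 then ofPath k (p.2.2.comp (q.2.2.cast h.symm rfl)) else 0

/-- The bilinear extension of the product of paths. -/
def mulLin : PathAlgebra k V →ₗ[k] PathAlgebra k V →ₗ[k] PathAlgebra k V :=
  Finsupp.lift (PathAlgebra k V →ₗ[k] PathAlgebra k V) k (Σ a b : V, Quiver.Path a b)
    fun p => Finsupp.lift (PathAlgebra k V) k (Σ a b : V, Quiver.Path a b) fun q => pathMul k p q

instance : Mul (PathAlgebra k V) := ⟨fun x y => mulLin k x y⟩

theorem mul_def (x y : PathAlgebra k V) : x * y = mulLin k x y := rfl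

theorem mulLin_ofPath {a b c d : V} (p : Quiver.Path a b) (q : Quiver.Path c d) :
    mulLin k (ofPath k p) (ofPath k q) = pathMul k ⟨a, b, p⟩ ⟨c, d, q⟩ := by
  have h1 : mulLin k (ofPath k p) =
      Finsupp.lift (PathAlgebra k V) k (Σ a b : V, Quiver.Path a b)
        fun q => pathMul k ⟨a, b, p⟩ q := by
    unfold mulLin ofPath
    refine (Finsupp.lift_apply _ _ _ _ _).trans ?_
    refine (Finsupp.sum_single_index ?_).trans ?_
    · exact zero_smul _ _
    · exact one_smul _ _
  rw [h1]
  unfold ofPath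
  refine (Finsupp.lift_apply _ _ _ _ _).trans ?_
  refine (Finsupp.sum_single_index ?_).trans ?_
  · exact zero_smul _ _
  · exact one_smul _ _

/-- Composable paths are multiplied by concatenation. -/
theorem ofPath_mul_ofPath {a b c : V} (p : Quiver.Path a b) (q : Quiver.Path b c) :
    ofPath k p * ofPath k q = ofPath k (p.comp q) := by
  rw [mul_def, mulLin_ofPath]
  simp [pathMul]

/-- The product of two paths that are not composable is zero. -/
theorem ofPath_mul_ofPath_of_ne {a b c d : V} (p : Quiver.Path a b) (q : Quiver.Path c d)
    (h : b ≠ c) : ofPath k p * ofPath k q = 0 := by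
  rw [mul_def, mulLin_ofPath]
  simp [pathMul, h]

/-- Linear maps on the path algebra agree if they agree on paths. -/
theorem hom_ext {M : Type*} [AddCommMonoid M] [Module k M] {f g : PathAlgebra k V →ₗ[k] M}
    (h : ∀ (a b : V) (p : Quiver.Path a b), f (ofPath k p) = g (ofPath k p)) : f = g :=
  Finsupp.lhom_ext' fun ⟨a, b, p⟩ => LinearMap.ext_ring (h a b p)

theorem mulLin_assoc (x y z : PathAlgebra k V) :
    mulLin k (mulLin k x y) z = mulLin k x (mulLin k y z) := by
  have key : (LinearMap.compr₂ (mulLin k (V := V)) (mulLin k)) =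
      ((LinearMap.llcomp k (PathAlgebra k V) (PathAlgebra k V) (PathAlgebra k V)).comp
        (mulLin k)).compl₂ (mulLin k) := by
    refine hom_ext k fun a b p => hom_ext k fun c d q => hom_ext k fun e f r => ?_
    change (ofPath k p * ofPath k q) * ofPath k r = ofPath k p * (ofPath k q * ofPath k r)
    have mz : ∀ x : PathAlgebra k V, x * 0 = 0 := fun x => (mulLin k x).map_zero
    have zm : ∀ x : PathAlgebra k V, 0 * x = 0 := fun x => by
      rw [mul_def, map_zero]; rfl
    by_cases h : b = c
    · subst h
      by_cases h' : d = e
      · subst h'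
        simp only [ofPath_mul_ofPath, Quiver.Path.comp_assoc]
      · rw [ofPath_mul_ofPath, ofPath_mul_ofPath_of_ne k _ _ h', ofPath_mul_ofPath_of_ne k _ _ h',
          mz]
    · rw [ofPath_mul_ofPath_of_ne k _ _ h, zm]
      by_cases h' : d = e
      · subst h'
        rw [ofPath_mul_ofPath, ofPath_mul_ofPath_of_ne k _ _ h]
      · rw [ofPath_mul_ofPath_of_ne k _ _ h', mz]
  exact LinearMap.congr_fun (LinearMap.congr_fun (LinearMap.congr_fun key x) y) z

end Basic

section Unital

variable (k : Type*) {V : Type*} [CommRing k] [Quiver V] [Fintype V]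

/-- The unit of the path algebra is the sum of the trivial paths. -/
instance : One (PathAlgebra k V) := ⟨∑ a : V, idem k a⟩

theorem one_def : (1 : PathAlgebra k V) = ∑ a : V, idem k a := rfl

theorem mulLin_one_left (x : PathAlgebra k V) : mulLin k 1 x = x := by
  have key : mulLin k (1 : PathAlgebra k V) = LinearMap.id := by
    refine hom_ext k fun a b p => ?_
    rw [one_def, map_sum, LinearMap.sum_apply]
    refine (Finset.sum_eq_single a ?_ ?_).trans ?_
    · intro c _ hc
      exact ofPath_mul_ofPath_of_ne k _ _ hc
    · intro h
      exact absurd (Finset.mem_univ a) h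
    · refine (ofPath_mul_ofPath k _ _).trans ?_
      rw [Quiver.Path.nil_comp]
      rfl
  rw [key]
  rfl

theorem mulLin_one_right (x : PathAlgebra k V) : mulLin k x 1 = x := by
  have key : (mulLin k (V := V)).flip 1 = LinearMap.id := by
    refine hom_ext k fun a b p => ?_
    rw [LinearMap.flip_apply, one_def, map_sum]
    refine (Finset.sum_eq_single b ?_ ?_).trans ?_
    · intro c _ hc
      exact ofPath_mul_ofPath_of_ne k _ _ hc.symm
    · intro h
      exact absurd (Finset.mem_univ b) h
    · exact ofPath_mul_ofPath k _ _
  exact LinearMap.congr_fun key x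

instance : Ring (PathAlgebra k V) :=
  { (inferInstance : AddCommGroup (PathAlgebra k V)) with
    mul := (· * ·)
    one := 1
    mul_assoc := mulLin_assoc k
    one_mul := mulLin_one_left k
    mul_one := mulLin_one_right k
    left_distrib := fun x y z => map_add (mulLin k x) y z
    right_distrib := fun x y z => by
      change mulLin k (x + y) z = mulLin k x z + mulLin k y z
      rw [map_add, LinearMap.add_apply]
    zero_mul := fun x => by
      change mulLin k 0 x = 0
      rw [map_zero, LinearMap.zero_apply]
    mul_zero := fun x => map_zero (mulLin k x) }

instance : Algebra k (PathAlgebra k V) :=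
  Algebra.ofModule
    (fun r x y => by
      change mulLin k (r • x) y = r • mulLin k x y
      rw [map_smul, LinearMap.smul_apply])
    (fun r x y => by
      change mulLin k x (r • y) = r • mulLin k x y
      rw [map_smul])

/-- The homogeneous piece of degree `s`, spanned by the paths of length `s`. -/
def piece (V : Type*) [Quiver V] (s : ℕ) : Submodule k (PathAlgebra k V) :=
  Submodule.span k {x | ∃ (a b : V) (p : Quiver.Path a b), p.length = s ∧ x = ofPath k p}

end Unital

end PathAlgebra

/-! Preprojective algebras. The double of a quiver on `V` is `Quiver.Symmetrify V`. -/

section Preprojective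

variable (k : Type*) {V : Type*} [CommRing k] [Quiver V]

/-- The arrow `α` of `Q`, as an element of the path algebra of the double of `Q`. -/
def doubleArrow {a b : V} (α : a ⟶ b) : PathAlgebra k (Quiver.Symmetrify V) :=
  PathAlgebra.ofPath k
    (Quiver.Hom.toPath (Sum.inl α : @Quiver.Hom (Quiver.Symmetrify V) _ a b))

/-- The arrow `α*` of the double of `Q`, from the target of `α` to the source of `α`, as an
element of the path algebra of the double. -/
def doubleArrowStar {a b : V} (α : a ⟶ b) : PathAlgebra k (Quiver.Symmetrify V) :=
  PathAlgebra.ofPath k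
    (Quiver.Hom.toPath (Sum.inr α : @Quiver.Hom (Quiver.Symmetrify V) _ b a))

instance instFintypeSymmetrify {V : Type*} [Fintype V] : Fintype (Quiver.Symmetrify V) :=
  inferInstanceAs (Fintype V)

variable (V)
variable [Fintype V] [∀ a b : V, Fintype (a ⟶ b)]

/-- The element `∑ α, (α α* - α* α)`, summed over all arrows `α` of `Q`. -/
def preprojectiveRelator : PathAlgebra k (Quiver.Symmetrify V) :=
  ∑ a : V, ∑ b : V, ∑ α : a ⟶ b,
    (doubleArrow k α * doubleArrowStar k α - doubleArrowStar k α * doubleArrow k α)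

/-- The preprojective algebra: the quotient of the path algebra of the double of `Q` by the
two-sided ideal generated by `∑ α, (α α* - α* α)`. -/
abbrev PreprojectiveAlgebra : Type _ :=
  RingQuot fun x y : PathAlgebra k (Quiver.Symmetrify V) => x = preprojectiveRelator k V ∧ y = 0

namespace PreprojectiveAlgebra

/-- The quotient map from the path algebra of the double. -/
def mk : PathAlgebra k (Quiver.Symmetrify V) →ₐ[k] PreprojectiveAlgebra k V :=
  RingQuot.mkAlgHom k _

/-- The homogeneous piece of degree `s`: the image of the span of the paths of length `s`. -/
def piece (s : ℕ) : Submodule k (PreprojectiveAlgebra k V) :=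
  (PathAlgebra.piece k (Quiver.Symmetrify V) s).map (mk k V).toLinearMap

variable {V}

/-- The idempotent `e_a` of the vertex `a`. -/
def idem (a : V) : PreprojectiveAlgebra k V :=
  mk k V (PathAlgebra.idem k (V := Quiver.Symmetrify V) a)

/-- The class of the arrow `α`. -/
def arrow {a b : V} (α : a ⟶ b) : PreprojectiveAlgebra k V := mk k V (doubleArrow k α)

/-- The class of the arrow `α*`. -/
def arrowStar {a b : V} (α : a ⟶ b) : PreprojectiveAlgebra k V := mk k V (doubleArrowStar k α)

end PreprojectiveAlgebra

end Preprojective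

/-! Vector traces of a graded automorphism that fixes the idempotents -/

section VectorTrace

variable {k B ι : Type*} [Field k] [Ring B] [Algebra k B]

/-- The subspace `e_j B_s`. -/
def rightPiece (𝒜 : ℕ → Submodule k B) (e : ι → B) (j : ι) (s : ℕ) : Submodule k B :=
  (𝒜 s).map (LinearMap.mulLeft k (e j))

/-- The subspace `B_s e_j`. -/
def leftPiece (𝒜 : ℕ → Submodule k B) (e : ι → B) (j : ι) (s : ℕ) : Submodule k B :=
  (𝒜 s).map (LinearMap.mulRight k (e j))

/-- An algebra automorphism is graded if it maps each homogeneous piece onto itself. -/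
def IsGradedAut (𝒜 : ℕ → Submodule k B) (g : B ≃ₐ[k] B) : Prop :=
  ∀ s, (𝒜 s).map g.toLinearMap = 𝒜 s

theorem mapsTo_rightPiece {𝒜 : ℕ → Submodule k B} {e : ι → B} {g : B ≃ₐ[k] B}
    (hg : IsGradedAut 𝒜 g) (he : ∀ i, g (e i) = e i) (j : ι) (s : ℕ) :
    ∀ x ∈ rightPiece 𝒜 e j s, g.toLinearMap x ∈ rightPiece 𝒜 e j s := by
  rintro _ ⟨y, hy, rfl⟩
  refine ⟨g y, ?_, ?_⟩
  · have h : g y ∈ (𝒜 s).map g.toLinearMap := ⟨y, hy, rfl⟩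
    rwa [hg s] at h
  · simp [he]

theorem mapsTo_leftPiece {𝒜 : ℕ → Submodule k B} {e : ι → B} {g : B ≃ₐ[k] B}
    (hg : IsGradedAut 𝒜 g) (he : ∀ i, g (e i) = e i) (j : ι) (s : ℕ) :
    ∀ x ∈ leftPiece 𝒜 e j s, g.toLinearMap x ∈ leftPiece 𝒜 e j s := by
  rintro _ ⟨y, hy, rfl⟩
  refine ⟨g y, ?_, ?_⟩
  · have h : g y ∈ (𝒜 s).map g.toLinearMap := ⟨y, hy, rfl⟩
    rwa [hg s] at h
  · simp [he]

/-- The vector trace with entries `∑ s, tr (g | e_j B_s) t ^ s`. -/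
def lowerVectorTrace {𝒜 : ℕ → Submodule k B} {e : ι → B} {g : B ≃ₐ[k] B}
    (hg : IsGradedAut 𝒜 g) (he : ∀ i, g (e i) = e i) : ι → k⟦X⟧ := fun j =>
  PowerSeries.mk fun s =>
    LinearMap.trace k (rightPiece 𝒜 e j s) (g.toLinearMap.restrict (mapsTo_rightPiece hg he j s))

/-- The vector trace with entries `∑ s, tr (g | B_s e_j) t ^ s`. -/
def upperVectorTrace {𝒜 : ℕ → Submodule k B} {e : ι → B} {g : B ≃ₐ[k] B}
    (hg : IsGradedAut 𝒜 g) (he : ∀ i, g (e i) = e i) : ι → k⟦X⟧ := fun j =>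
  PowerSeries.mk fun s =>
    LinearMap.trace k (leftPiece 𝒜 e j s) (g.toLinearMap.restrict (mapsTo_leftPiece hg he j s))

end VectorTrace

/-! The extended Dynkin quiver with `n` vertices of type `D` -/

/-- The vertices `1, …, n`. -/
def DTilde (n : ℕ) : Type := ↥(Finset.Icc 1 n)

namespace DTilde

variable {n : ℕ}

instance : Fintype (DTilde n) := inferInstanceAs (Fintype ↥(Finset.Icc 1 n))

instance : DecidableEq (DTilde n) := inferInstanceAs (DecidableEq ↥(Finset.Icc 1 n))

/-- The label, from `1` to `n`, of a vertex. -/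
def label (v : DTilde n) : ℕ := v.1

/-- For `n ≥ 5`: there is an arrow with label `i` from the vertex `a` to the vertex `b`. That is,
`α_1 : 1 → 3`, `α_2 : 2 → 3`, `α_i : i → i + 1` for `3 ≤ i ≤ n - 3`,
`α_{n-1} : n - 2 → n - 1` and `α_n : n - 2 → n`. -/
def IsArrow (n i a b : ℕ) : Prop :=
  ((i = 1 ∨ i = 2) ∧ a = i ∧ b = 3) ∨
  ((3 ≤ i ∧ i ≤ n - 3) ∧ a = i ∧ b = i + 1) ∨
  ((i = n - 1 ∨ i = n) ∧ a = n - 2 ∧ b = i)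

instance (n i a b : ℕ) : Decidable (IsArrow n i a b) := by
  unfold IsArrow
  infer_instance

instance : Quiver (DTilde n) where
  Hom a b := {i : ↥(Finset.Icc 1 n) // IsArrow n i.1 a.label b.label}

/-- The label `i` of the arrow `α_i`. -/
def arrowLabel {a b : DTilde n} (α : a ⟶ b) : ℕ := α.1.1

instance (a b : DTilde n) : Fintype (a ⟶ b) :=
  inferInstanceAs (Fintype {i : ↥(Finset.Icc 1 n) // IsArrow n i.1 a.label b.label})

/-- The entry of the matrix `M(c_i, t_i, t)` in row `i` and column `j`, for `1 ≤ i, j ≤ n`; the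
formal variable `t` of the power series is `PowerSeries.X`. The values of `c` and `t` at labels
that belong to no arrow are not used. -/
def traceEntry {k : Type*} [Field k] (n : ℕ) (c t : ℕ → k) (i j : ℕ) : k⟦X⟧ :=
  if i = j then 1 + PowerSeries.C (c 1 * t 1) * PowerSeries.X ^ 2
  -- the entries of the arrows 1 and 2
  else if (i = 1 ∨ i = 2) ∧ j = 3 then -(PowerSeries.C (c i) * PowerSeries.X)
  else if i = 3 ∧ (j = 1 ∨ j = 2) then -(PowerSeries.C (t j) * PowerSeries.X)
  -- the entries of the arrows 3, …, n - 3
  else if (3 ≤ i ∧ i ≤ n - 3) ∧ j = i + 1 then -(PowerSeries.C (c i) * PowerSeries.X)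
  else if (3 ≤ j ∧ j ≤ n - 3) ∧ i = j + 1 then -(PowerSeries.C (t j) * PowerSeries.X)
  -- the entries of the arrows n - 1 and n
  else if i = n - 2 ∧ (j = n - 1 ∨ j = n) then -(PowerSeries.C (c j) * PowerSeries.X)
  else if (i = n - 1 ∨ i = n) ∧ j = n - 2 then -(PowerSeries.C (t i) * PowerSeries.X)
  else 0

/-- The matrix `M(c_i, t_i, t)`. -/
def traceMatrix {k : Type*} [Field k] (n : ℕ) (c t : ℕ → k) :
    Matrix (DTilde n) (DTilde n) k⟦X⟧ :=
  Matrix.of fun a b => traceEntry n c t a.label b.label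

end DTilde

end

/-! Let `T j` be the entry of the upper trace at `j`. Right multiplication by the arrows `β : h → j`
of the double gives mesh sequences `0 → A_s e_j → ⨁ A_{s+1} e_h → A_{s+2} e_j → 0`. The automorphism
acts on them by `g` on the right, by `γ(β) g` on the summand of `β` (where `g β = γ(β) β`), and by
`c_1 t_1 g` on the left. Once they are exact, additivity of traces gives `(1 + c_1 t_1 X²) T_j - ∑
γ(β) X T_h = 1`, a linear system whose matrix is the identity modulo `X`.

Right exactness holds over any finite quiver, by deleting last arrows (`dropLast_mem_range`).
Injectivity on the left is where the type of the quiver enters. The vector `δ = (1, 1, 2, …, 2, 1,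
1)` satisfies `∑ δ_j = 2 δ_h` over the neighbours `j` of `h`. Fix `i`, and let `s` be the first
degree in which some nonzero `x` in `e_i A_s e_j` is killed by all arrows. Up to there the
`δ`-weighted dimensions grow linearly, so degree `s + 1` is nonzero. The rank one map `y ↦ φ(y) x`
in degree `s`, together with zero in degree `s + 1`, commutes with the arrows. Such pairs descend to
degree `0`, where only scalars exist, so the pair is a scalar; it is zero in degree `s + 1`, hence
zero, contradicting `φ(x) ≠ 0`. This is `Mesh.IsRightExact.outgoing_injective`.

That the products `c_i t_i` all agree follows from exactness as well: `g` sends the relation at a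
vertex to a multiple of itself (`exists_mul_reverse_eq`), and the quiver is connected. The lower
trace reduces to the upper one by the anti-involution `α ↔ α*`, which exchanges the `c_i` and the
`t_i` (`lowerVectorTrace_eq`). -/

set_option linter.unusedSectionVars false

noncomputable section

/-! Families of vector spaces with mesh relations -/

namespace Mesh

variable {k V : Type*} [Field k] [Quiver V] [Quiver.HasInvolutiveReverse V] [Fintype V]
  [∀ a b : V, Fintype (a ⟶ b)] {W : V → ℕ → Type*} [∀ j s, AddCommGroup (W j s)]
  [∀ j s, Module k (W j s)]

/-- The joint action of all arrows with target `j`. -/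
def incoming (L : ∀ {h j : V}, (h ⟶ j) → ∀ s, W h s →ₗ[k] W j (s + 1)) (j : V) (s : ℕ) :
    (∀ p : Σ h : V, (h ⟶ j), W p.1 s) →ₗ[k] W j (s + 1) :=
  ∑ p : Σ h : V, (h ⟶ j), (L p.2 s).comp (LinearMap.proj p)

/-- The weighted action of the reverses of all arrows with target `j`. -/
def outgoing (L : ∀ {h j : V}, (h ⟶ j) → ∀ s, W h s →ₗ[k] W j (s + 1))
    (ε : ∀ {h j : V}, (h ⟶ j) → k) (j : V) (s : ℕ) :
    W j s →ₗ[k] ∀ p : Σ h : V, (h ⟶ j), W p.1 (s + 1) :=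
  LinearMap.pi fun p => ε p.2 • L (Quiver.reverse p.2) s

/-- The sequences `W j s → ⨁ W h (s + 1) → W j (s + 2) → 0` and `0 → ⨁ W h 0 → W j 1 → 0` are
exact. -/
structure IsRightExact (L : ∀ {h j : V}, (h ⟶ j) → ∀ s, W h s →ₗ[k] W j (s + 1))
    (ε : ∀ {h j : V}, (h ⟶ j) → k) : Prop where
  ne_zero : ∀ {h j : V} (β : h ⟶ j), ε β ≠ 0
  surjective : ∀ j s, Function.Surjective (incoming L j s)
  injective : ∀ j, Function.Injective (incoming L j 0)
  exact : ∀ j s, Function.Exact (outgoing L ε j s) (incoming L j (s + 1))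

variable {L : ∀ {h j : V}, (h ⟶ j) → ∀ s, W h s →ₗ[k] W j (s + 1)}
  {ε : ∀ {h j : V}, (h ⟶ j) → k}

theorem incoming_apply (j : V) (s : ℕ) (y : ∀ p : Σ h : V, (h ⟶ j), W p.1 s) :
    incoming L j s y = ∑ p, L p.2 s (y p) := by
  simp [incoming]

theorem outgoing_apply (j : V) (s : ℕ) (x : W j s) (p : Σ h : V, (h ⟶ j)) :
    outgoing L ε j s x p = ε p.2 • L (Quiver.reverse p.2) s x := rfl

/-- A pair of consecutive homogeneous components of an endomorphism is a scalar. -/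
theorem IsRightExact.endomorphism_eq_smul (H : IsRightExact L ε)
    (h0 : ∀ f : ∀ j, W j 0 →ₗ[k] W j 0, ∃ c : k, ∀ j x, f j x = c • x) (s : ℕ)
    (hinj : ∀ r < s, ∀ j, Function.Injective (outgoing L ε j r))
    (f : ∀ j, W j s →ₗ[k] W j s) (f' : ∀ j, W j (s + 1) →ₗ[k] W j (s + 1))
    (comm : ∀ (h j : V) (β : h ⟶ j) x, f' j (L β s x) = L β s (f h x)) :
    ∃ c : k, (∀ j x, f j x = c • x) ∧ ∀ j x, f' j x = c • x := by
  induction s with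
  | zero =>
    obtain ⟨c, hc⟩ := h0 f
    refine ⟨c, hc, fun j x => ?_⟩
    obtain ⟨y, rfl⟩ := H.surjective j 0 x
    simp [incoming_apply, map_sum, comm, hc, Finset.smul_sum]
  | succ s ih =>
    -- Applying `f` componentwise preserves the kernel of `incoming`, because `f'` intertwines. By
    -- exactness the result comes from degree `s`; injectivity makes the preimage unique, hence
    -- linear in `x`.
    have hmem : ∀ j (x : W j s), ∃ z : W j s, outgoing L ε j s z =
        fun p => f p.1 (outgoing L ε j s x p) := by
      intro j x
      refine (H.exact j s _).1 ?_
      have hx := (H.exact j s).apply_apply_eq_zero x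
      rw [incoming_apply] at hx ⊢
      simp only [← comm]
      rw [← map_sum, hx, map_zero]
    choose g hg using hmem
    have hinjs : ∀ j, Function.Injective (outgoing L ε j s) := hinj s (Nat.lt_succ_self s)
    let G : ∀ j, W j s →ₗ[k] W j s := fun j =>
      { toFun := g j
        map_add' := fun x y => hinjs j <| by
          rw [map_add, hg, hg, hg]
          ext p
          simp
        map_smul' := fun r x => hinjs j <| by
          rw [map_smul, hg, hg]
          ext p
          simp }
    have hG : ∀ (h j : V) (β : h ⟶ j) x, f j (L β s x) = L β s (G h x) := by
      intro h j β x
      have := congrFun (hg h x) ⟨j, Quiver.reverse β⟩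
      simp only [outgoing_apply, Quiver.reverse_reverse, map_smul] at this
      exact (smul_right_injective _ (H.ne_zero (Quiver.reverse β)) this).symm
    obtain ⟨c, -, hc⟩ := ih (fun r hr => hinj r (hr.trans (Nat.lt_succ_self s))) G f hG
    refine ⟨c, hc, fun j x => ?_⟩
    obtain ⟨y, rfl⟩ := H.surjective j (s + 1) x
    simp [incoming_apply, map_sum, comm, hc, Finset.smul_sum]

/-! ### Weighted dimensions and injectivity on the left -/

section Finite

variable [∀ j s, Module.Finite k (W j s)]

/-- The weighted dimension of the degree `s` part. -/
def weight (k : Type*) {V : Type*} [Field k] [Fintype V] (W : V → ℕ → Type*)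
    [∀ j s, AddCommGroup (W j s)] [∀ j s, Module k (W j s)] (δ : V → ℕ) (s : ℕ) : ℕ :=
  ∑ j, δ j * Module.finrank k (W j s)

/-- After exchanging the sums, `finrank (W h s)` is counted once for each arrow out of `h`, with
total weight `2 δ h`. -/
theorem sum_weight {δ : V → ℕ} (hδ : ∀ h, ∑ j, Fintype.card (h ⟶ j) * δ j = 2 * δ h) (s : ℕ) :
    ∑ j, δ j * Module.finrank k (∀ p : Σ h : V, (h ⟶ j), W p.1 s) = 2 * weight k W δ s := by
  simp only [Module.finrank_pi_fintype, Fintype.sum_sigma, Finset.mul_sum, weight]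
  rw [Finset.sum_comm]
  refine Finset.sum_congr rfl fun h _ => ?_
  rw [← mul_assoc, ← hδ h, Finset.sum_mul]
  exact Finset.sum_congr rfl fun j _ => by
    change ∑ _i : (h ⟶ j), δ j * Module.finrank k (W h s) = _
    rw [Finset.sum_const, Finset.card_univ, smul_eq_mul]
    ring

theorem IsRightExact.weight_one (H : IsRightExact L ε) {δ : V → ℕ}
    (hδ : ∀ h, ∑ j, Fintype.card (h ⟶ j) * δ j = 2 * δ h) :
    weight k W δ 1 = 2 * weight k W δ 0 := by
  rw [← sum_weight hδ]
  refine Finset.sum_congr rfl fun j _ => ?_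
  rw [(LinearEquiv.ofBijective _ ⟨H.injective j, H.surjective j 0⟩).finrank_eq]

theorem IsRightExact.weight_add_two (H : IsRightExact L ε) {δ : V → ℕ}
    (hδ : ∀ h, ∑ j, Fintype.card (h ⟶ j) * δ j = 2 * δ h) {s : ℕ}
    (hinj : ∀ j, Function.Injective (outgoing L ε j s)) :
    weight k W δ (s + 2) + weight k W δ s = 2 * weight k W δ (s + 1) := by
  rw [← sum_weight hδ, weight, weight, ← Finset.sum_add_distrib]
  refine Finset.sum_congr rfl fun j _ => ?_
  rw [← (incoming L j (s + 1)).finrank_range_add_finrank_ker,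
    LinearMap.range_eq_top.2 (H.surjective j (s + 1)), finrank_top,
    (H.exact j s).linearMap_ker_eq, LinearMap.finrank_range_of_inj (hinj j), mul_add]

/-- The recursion `w_{s+2} = 2 w_{s+1} - w_s` with `w_1 = 2 w_0` has a linear solution. Injectivity
below `s` already controls degree `s + 1`, which is what excludes a first failure in degree `s`. -/
theorem IsRightExact.weight_eq (H : IsRightExact L ε) {δ : V → ℕ}
    (hδ : ∀ h, ∑ j, Fintype.card (h ⟶ j) * δ j = 2 * δ h) (s : ℕ)
    (hinj : ∀ r < s, ∀ j, Function.Injective (outgoing L ε j r)) :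
    weight k W δ s = (s + 1) * weight k W δ 0 ∧
      weight k W δ (s + 1) = (s + 2) * weight k W δ 0 := by
  induction s with
  | zero => exact ⟨by ring, by rw [H.weight_one hδ]⟩
  | succ s ih =>
    obtain ⟨h1, h2⟩ := ih fun r hr => hinj r (hr.trans (Nat.lt_succ_self s))
    have h3 := H.weight_add_two hδ (hinj s (Nat.lt_succ_self s))
    refine ⟨h2, ?_⟩
    rw [h1, h2] at h3
    have : weight k W δ (s + 2) + (s + 1) * weight k W δ 0 =
      (s + 1 + 2) * weight k W δ 0 + (s + 1) * weight k W δ 0 := by rw [h3]; ring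
    exact Nat.add_right_cancel this

/-- If there is an additive function and the degree zero part is a single brick of positive
weight, then the mesh sequences are exact on the left as well. -/
theorem IsRightExact.outgoing_injective (H : IsRightExact L ε) {δ : V → ℕ}
    (hδ : ∀ h, ∑ j, Fintype.card (h ⟶ j) * δ j = 2 * δ h)
    (h0 : ∀ f : ∀ j, W j 0 →ₗ[k] W j 0, ∃ c : k, ∀ j x, f j x = c • x)
    (hpos : 0 < weight k W δ 0) (s : ℕ) :
    ∀ j, Function.Injective (outgoing L ε j s) := by
  classical
  induction s using Nat.strong_induction_on with
  | _ s ih =>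
    intro j
    rw [injective_iff_map_eq_zero]
    intro x hx
    by_contra hne
    obtain ⟨φ, hφ⟩ : ∃ φ : Module.Dual k (W j s), φ x ≠ 0 := by
      by_contra! hall
      exact hne ((Module.forall_dual_apply_eq_zero_iff k x).1 hall)
    -- The map `y ↦ φ(y) x` at `j`, zero at the other vertices. As all arrows kill `x`, it is
    -- compatible with zero in degree `s + 1`.
    let f : ∀ i, W i s →ₗ[k] W i s := Pi.single j (φ.smulRight x)
    have hL : ∀ {i : V} (β : j ⟶ i), L β s x = 0 := by
      intro i β
      have := congrFun hx ⟨i, Quiver.reverse β⟩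
      simpa [outgoing_apply, H.ne_zero] using this
    obtain ⟨c, hc, hc'⟩ := H.endomorphism_eq_smul h0 s ih f (fun _ => 0) <| by
      intro h i β y
      by_cases hj : h = j
      · subst hj
        simp [f, hL]
      · simp [f, hj]
    -- Positive weight yields a nonzero space in degree `s + 1`, on which the scalar `c` acts as
    -- zero.
    have hw := (H.weight_eq hδ s ih).2
    have hex : ∃ i, Module.finrank k (W i (s + 1)) ≠ 0 := by
      by_contra! hall
      have : weight k W δ (s + 1) = 0 := by simp [weight, hall]
      exact (Nat.mul_pos (Nat.succ_pos (s + 1)) hpos).ne' (hw.symm.trans this)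
    obtain ⟨i, hi⟩ := hex
    have := Module.nontrivial_of_finrank_pos (Nat.pos_of_ne_zero hi)
    obtain ⟨y, hy⟩ := exists_ne (0 : W i (s + 1))
    have hc0 : c = 0 := by
      have := hc' i y
      simpa [hy] using this.symm
    have := hc j x
    simp [f, hc0, hφ, hne] at this

end Finite

end Mesh

/-! Traces -/

theorem LinearMap.trace_of_exact {k M N P : Type*} [Field k] [AddCommGroup M] [AddCommGroup N]
    [AddCommGroup P] [Module k M] [Module k N] [Module k P] [Module.Finite k M]
    [Module.Finite k N] [Module.Finite k P] {i : M →ₗ[k] N} {p : N →ₗ[k] P}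
    (hi : Function.Injective i) (hp : Function.Surjective p) (hip : Function.Exact i p)
    {f : M →ₗ[k] M} {g : N →ₗ[k] N} {h : P →ₗ[k] P} (hf : g ∘ₗ i = i ∘ₗ f)
    (hh : p ∘ₗ g = h ∘ₗ p) :
    LinearMap.trace k N g = LinearMap.trace k M f + LinearMap.trace k P h := by
  obtain ⟨σ, hσ⟩ := p.exists_rightInverse_of_surjective (LinearMap.range_eq_top.2 hp)
  obtain ⟨ρ, hρ⟩ := i.exists_leftInverse_of_injective (LinearMap.ker_eq_bot.2 hi)
  have hpi : p ∘ₗ i = 0 := hip.linearMap_comp_eq_zero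
  -- The map `id - σ p` lands in `ker p = im i`, where `i ρ` is the identity. Hence `τ = ρ (id - σ
  -- p)` is the retraction adapted to the section `σ`.
  have h1 : i ∘ₗ ρ ∘ₗ (LinearMap.id - σ ∘ₗ p) = LinearMap.id - σ ∘ₗ p := by
    ext x
    have : p ((LinearMap.id - σ ∘ₗ p : N →ₗ[k] N) x) = 0 := by
      have := LinearMap.congr_fun hσ (p x)
      simp only [LinearMap.comp_apply, LinearMap.id_apply] at this
      simp [this]
    obtain ⟨m, hm⟩ := (hip _).1 this
    have := LinearMap.congr_fun hρ m
    simp only [LinearMap.comp_apply, LinearMap.id_apply] at this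
    simp only [LinearMap.comp_apply]
    rw [← hm, this]
  obtain ⟨τ, h1, h2⟩ :
      ∃ τ : N →ₗ[k] M, i ∘ₗ τ = LinearMap.id - σ ∘ₗ p ∧ τ ∘ₗ i = LinearMap.id := by
    refine ⟨_, h1, ?_⟩
    rw [LinearMap.comp_assoc, LinearMap.sub_comp, LinearMap.comp_assoc, hpi]
    simpa using hρ
  -- Moving `i` and `σ` to the other end under the trace turns the two summands into `f` and `h`.
  have h3 : g = i ∘ₗ (τ ∘ₗ g) + σ ∘ₗ (p ∘ₗ g) := by
    rw [← LinearMap.comp_assoc g τ i, h1]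
    ext x
    simp
  have h4 : (τ ∘ₗ g) ∘ₗ i = f := by
    rw [LinearMap.comp_assoc, hf, ← LinearMap.comp_assoc f i τ, h2, LinearMap.id_comp]
  have h5 : (p ∘ₗ g) ∘ₗ σ = h := by
    rw [hh, LinearMap.comp_assoc, hσ, LinearMap.comp_id]
  rw [h3, map_add, LinearMap.trace_comp_comm' (τ ∘ₗ g) i, LinearMap.trace_comp_comm' (p ∘ₗ g) σ,
    h4, h5]

theorem LinearMap.trace_piMap {k ι : Type*} [Field k] [Fintype ι] {M : ι → Type*}
    [∀ i, AddCommGroup (M i)] [∀ i, Module k (M i)] [∀ i, Module.Finite k (M i)]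
    (f : ∀ i, M i →ₗ[k] M i) :
    LinearMap.trace k (∀ i, M i) (LinearMap.piMap f) = ∑ i, LinearMap.trace k (M i) (f i) := by
  classical
  have h : LinearMap.piMap f =
      ∑ i, LinearMap.single k M i ∘ₗ (f i ∘ₗ LinearMap.proj i) := by
    ext i x j
    by_cases hij : j = i
    · subst hij
      simp [Finset.sum_apply]
    · simp [Finset.sum_apply, hij]
  rw [h, map_sum]
  refine Finset.sum_congr rfl fun i _ => ?_
  rw [LinearMap.trace_comp_comm']
  congr 1
  ext x
  simp

end

noncomputable section

/-! ### The length grading of the path algebra -/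

namespace PathAlgebra

variable {k V : Type*} [CommRing k] [Quiver V]

section Lift

variable {M : Type*} [AddCommGroup M] [Module k M]

/-- The linear map on the path algebra with given values on the paths. -/
def lift (F : ∀ a b : V, Quiver.Path a b → M) : PathAlgebra k V →ₗ[k] M :=
  Finsupp.lift M k (Σ a b : V, Quiver.Path a b) fun p => F p.1 p.2.1 p.2.2

theorem lift_ofPath (F : ∀ a b : V, Quiver.Path a b → M) {a b : V} (p : Quiver.Path a b) :
    lift F (ofPath k p) = F a b p := by
  unfold lift ofPath
  refine (Finsupp.lift_apply _ _ _ _ _).trans ?_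
  refine (Finsupp.sum_single_index ?_).trans ?_
  · exact zero_smul _ _
  · exact one_smul _ _

end Lift

theorem ofPath_ne_zero [Nontrivial k] {a b : V} (p : Quiver.Path a b) : ofPath k p ≠ 0 := by
  intro h
  have h1 := lift_ofPath (k := k) (M := k) (fun _ _ _ => 1) p
  rw [h, map_zero] at h1
  exact zero_ne_one h1

theorem ofPath_mem_piece {a b : V} (p : Quiver.Path a b) : ofPath k p ∈ piece k V p.length :=
  Submodule.subset_span ⟨a, b, p, rfl, rfl⟩

/-- The projection to the homogeneous piece of degree `s`. -/
def proj (k V : Type*) [CommRing k] [Quiver V] (s : ℕ) : PathAlgebra k V →ₗ[k] PathAlgebra k V :=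
  lift fun _ _ p => if p.length = s then ofPath k p else 0

theorem proj_ofPath (s : ℕ) {a b : V} (p : Quiver.Path a b) :
    proj k V s (ofPath k p) = if p.length = s then ofPath k p else 0 :=
  lift_ofPath _ _

theorem proj_of_mem {s m : ℕ} {x : PathAlgebra k V} (hx : x ∈ piece k V m) :
    proj k V s x = if m = s then x else 0 := by
  induction hx using Submodule.span_induction with
  | mem x h =>
    obtain ⟨a, b, p, rfl, rfl⟩ := h
    exact proj_ofPath s p
  | zero => simp
  | add x y _ _ hx hy => rw [map_add, hx, hy]; split_ifs <;> simp
  | smul c x _ hx => rw [map_smul, hx]; split_ifs <;> simp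

theorem proj_mem (s : ℕ) (x : PathAlgebra k V) : proj k V s x ∈ piece k V s := by
  have key : (piece k V s).mkQ ∘ₗ proj k V s = 0 := by
    refine hom_ext k fun a b p => ?_
    rw [LinearMap.comp_apply, proj_ofPath]
    split_ifs with h
    · subst h
      simpa using ofPath_mem_piece p
    · simp
  simpa using LinearMap.congr_fun key x

section Unital

variable [Fintype V]

theorem ofPath_mul_mem_piece {a b c d : V} (p : Quiver.Path a b) (q : Quiver.Path c d) :
    ofPath k p * ofPath k q ∈ piece k V (p.length + q.length) := by
  by_cases h : b = c
  · subst h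
    rw [ofPath_mul_ofPath, ← Quiver.Path.length_comp]
    exact ofPath_mem_piece _
  · rw [ofPath_mul_ofPath_of_ne k _ _ h]
    exact zero_mem _

theorem mul_mem_piece {m n : ℕ} {x y : PathAlgebra k V} (hx : x ∈ piece k V m)
    (hy : y ∈ piece k V n) : x * y ∈ piece k V (m + n) := by
  induction hx using Submodule.span_induction with
  | mem x h =>
    obtain ⟨a, b, p, rfl, rfl⟩ := h
    induction hy using Submodule.span_induction with
    | mem y h =>
      obtain ⟨c, d, q, rfl, rfl⟩ := h
      exact ofPath_mul_mem_piece p q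
    | zero => rw [mul_zero]; exact zero_mem _
    | add y z _ _ hy hz => rw [mul_add]; exact add_mem hy hz
    | smul c y _ hy => rw [mul_smul_comm]; exact Submodule.smul_mem _ _ hy
  | zero => rw [zero_mul]; exact zero_mem _
  | add y z _ _ hy hz => rw [add_mul]; exact add_mem hy hz
  | smul c y _ hy => rw [smul_mul_assoc]; exact Submodule.smul_mem _ _ hy

theorem one_mem_piece : (1 : PathAlgebra k V) ∈ piece k V 0 :=
  sum_mem fun a _ => ofPath_mem_piece (Quiver.Path.nil : Quiver.Path a a)

theorem ofPath_mul_idem {a b : V} (p : Quiver.Path a b) :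
    ofPath k p * idem k b = ofPath k p :=
  ofPath_mul_ofPath k p Quiver.Path.nil

theorem idem_mul_ofPath {a b : V} (p : Quiver.Path a b) :
    idem k a * ofPath k p = ofPath k p := by
  rw [idem, ofPath_mul_ofPath, Quiver.Path.nil_comp]

theorem ofPath_cons {a b c : V} (p : Quiver.Path a b) (e : b ⟶ c) :
    ofPath k (p.cons e) = ofPath k p * ofPath k e.toPath :=
  (ofPath_mul_ofPath k p e.toPath).symm

theorem proj_mul_arrow {h j : V} (s : ℕ) (x : PathAlgebra k V) (β : h ⟶ j) :
    proj k V (s + 1) (x * ofPath k β.toPath) = proj k V s x * ofPath k β.toPath := by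
  have key : proj k V (s + 1) ∘ₗ LinearMap.mulRight k (ofPath k β.toPath) =
      LinearMap.mulRight k (ofPath k β.toPath) ∘ₗ proj k V s := by
    refine hom_ext k fun a b p => ?_
    simp only [LinearMap.comp_apply, LinearMap.mulRight_apply]
    rw [proj_of_mem (ofPath_mul_mem_piece p β.toPath), proj_ofPath]
    simp only [Quiver.Path.length_toPath, Nat.add_right_cancel_iff]
    split_ifs <;> simp
  exact LinearMap.congr_fun key x

theorem proj_zero_mul_arrow {h j : V} (x : PathAlgebra k V) (β : h ⟶ j) :
    proj k V 0 (x * ofPath k β.toPath) = 0 := by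
  have key : proj k V 0 ∘ₗ LinearMap.mulRight k (ofPath k β.toPath) = 0 := by
    refine hom_ext k fun a b p => ?_
    simp only [LinearMap.comp_apply, LinearMap.mulRight_apply]
    rw [proj_of_mem (ofPath_mul_mem_piece p β.toPath)]
    simp
  exact LinearMap.congr_fun key x

end Unital

end PathAlgebra

instance Quiver.Symmetrify.instFintypeHom {V : Type*} [Quiver V] [∀ a b : V, Fintype (a ⟶ b)]
    (a b : Quiver.Symmetrify V) : Fintype (a ⟶ b) :=
  @instFintypeSum _ _ ((inferInstance : ∀ a b : V, Fintype (a ⟶ b)) a b)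
    ((inferInstance : ∀ a b : V, Fintype (a ⟶ b)) b a)

/-! ### The ideal of relations and the deletion of last arrows -/

namespace PreprojectiveAlgebra

open PathAlgebra

/-- The sign with which the reverse of an arrow of the double, followed by the arrow itself, occurs
in the preprojective relation. -/
def sign (k : Type*) {V : Type*} [CommRing k] [Quiver V] {h j : Quiver.Symmetrify V}
    (β : h ⟶ j) : k :=
  Sum.elim (fun _ => -1) (fun _ => 1) β

section Ring

variable {k V : Type*} [CommRing k] [Quiver V] [Fintype V] [∀ a b : V, Fintype (a ⟶ b)]

/-- Each `α` contributes two arrows of the double: `α* α` ends with `α` and has sign `-1`, `α α*`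
ends with `α*` and has sign `1`. In this form last arrows can be deleted uniformly. -/
theorem relator_eq : preprojectiveRelator k V =
    ∑ β : Σ j h : Quiver.Symmetrify V, (h ⟶ j), sign k β.2.2 •
      (ofPath k (Quiver.reverse β.2.2).toPath * ofPath k β.2.2.toPath) := by
  simp only [Fintype.sum_sigma]
  let F : V → V → PathAlgebra k (Quiver.Symmetrify V) := fun a b =>
    ∑ α : a ⟶ b, doubleArrow k α * doubleArrowStar k α
  let G : V → V → PathAlgebra k (Quiver.Symmetrify V) := fun a b =>
    ∑ α : a ⟶ b, doubleArrowStar k α * doubleArrow k α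
  have h1 : ∀ j h : Quiver.Symmetrify V, ∑ β : h ⟶ j, sign k β •
      (ofPath k (Quiver.reverse β).toPath * ofPath k β.toPath) = F j h - G h j := by
    intro j h
    let I : ∀ a b : V, Fintype (a ⟶ b) := inferInstance
    refine (@Fintype.sum_sum_type _ _ _ (I h j) (I j h) _ _).trans ?_
    rw [add_comm, sub_eq_add_neg, ← Finset.sum_neg_distrib]
    congr 1
    · exact Finset.sum_congr rfl fun α _ => one_smul _ _
    · exact Finset.sum_congr rfl fun α _ => neg_one_smul _ _
  have h2 : preprojectiveRelator k V = ∑ j : V, ∑ h : V, (F j h - G h j) := by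
    simp only [preprojectiveRelator, Finset.sum_sub_distrib]
    congr 1
    exact Finset.sum_comm
  rw [h2]
  exact Finset.sum_congr rfl fun j _ => Finset.sum_congr rfl fun h _ => (h1 j h).symm

theorem mk_surjective : Function.Surjective (mk k V) := RingQuot.mkAlgHom_surjective _ _

theorem mk_relator : mk k V (preprojectiveRelator k V) = 0 := by
  rw [← map_zero (mk k V)]
  exact RingQuot.mkAlgHom_rel k ⟨rfl, rfl⟩

/-- Serves as the statement that the kernel of `mk` is spanned by the products `u r w`, with `r` the
relator. -/
theorem map_eq_zero_of_mk_eq_zero {M : Type*} [AddCommGroup M] [Module k M]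
    (f : PathAlgebra k (Quiver.Symmetrify V) →ₗ[k] M)
    (hf : ∀ u w, f (u * preprojectiveRelator k V * w) = 0)
    {x : PathAlgebra k (Quiver.Symmetrify V)} (hx : mk k V x = 0) : f x = 0 := by
  have hx' : mk k V x = mk k V 0 := by rw [hx, map_zero]
  simp only [mk, RingQuot.mkAlgHom_def, RingQuot.mkRingHom_def] at hx'
  have h := Quot.eqvGen_exact (congrArg RingQuot.toQuot hx')
  -- The factors `u` and `w` are quantified so that the induction passes through multiplication on
  -- either side.
  have hrel : ∀ a b, RingQuot.Rel (fun x y : PathAlgebra k (Quiver.Symmetrify V) =>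
      x = preprojectiveRelator k V ∧ y = 0) a b → ∀ u w, f (u * (a - b) * w) = 0 := by
    intro a b hab
    induction hab with
    | of h =>
      obtain ⟨rfl, rfl⟩ := h
      simpa using hf
    | add_left _ ih => simpa using ih
    | mul_left _ ih =>
      rename_i c _
      intro u w
      rw [← sub_mul, ← mul_assoc, mul_assoc]
      exact ih u (c * w)
    | mul_right _ ih =>
      rename_i c _ _ _
      intro u w
      rw [← mul_sub, ← mul_assoc]
      exact ih _ w
  have key : ∀ a b, Relation.EqvGen (RingQuot.Rel (fun x y : PathAlgebra k (Quiver.Symmetrify V) =>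
      x = preprojectiveRelator k V ∧ y = 0)) a b → f a = f b := by
    intro a b hab
    induction hab with
    | rel a b h =>
      have := hrel a b h 1 1
      rwa [one_mul, mul_one, map_sub, sub_eq_zero] at this
    | refl => rfl
    | symm _ _ _ ih => exact ih.symm
    | trans _ _ _ _ _ ih1 ih2 => exact ih1.trans ih2
  rw [key x 0 h, map_zero]

theorem relator_mem_piece :
    preprojectiveRelator k V ∈ PathAlgebra.piece k (Quiver.Symmetrify V) 2 := by
  rw [relator_eq]
  refine sum_mem fun β _ => Submodule.smul_mem _ _ ?_
  exact ofPath_mul_mem_piece (Quiver.reverse β.2.2).toPath β.2.2.toPath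

/-- Linear maps that kill the multiples of the relator by paths kill the kernel of the quotient
map. -/
theorem map_eq_zero_of_mk_eq_zero' {M : Type*} [AddCommGroup M] [Module k M]
    (f : PathAlgebra k (Quiver.Symmetrify V) →ₗ[k] M)
    (hf : ∀ (a b c d : Quiver.Symmetrify V) (p : Quiver.Path a b) (q : Quiver.Path c d),
      f (ofPath k p * preprojectiveRelator k V * ofPath k q) = 0)
    {x : PathAlgebra k (Quiver.Symmetrify V)} (hx : mk k V x = 0) : f x = 0 := by
  refine map_eq_zero_of_mk_eq_zero f (fun u w => ?_) hx
  have h1 : ∀ w, f ∘ₗ LinearMap.mulRight k w ∘ₗ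
      LinearMap.mulRight k (preprojectiveRelator k V) = 0 := by
    intro w
    refine hom_ext k fun a b p => ?_
    have h2 : f ∘ₗ LinearMap.mulLeft k (ofPath k p * preprojectiveRelator k V) = 0 :=
      hom_ext k fun c d q => hf a b c d p q
    exact LinearMap.congr_fun h2 w
  exact LinearMap.congr_fun (h1 w) u

theorem proj_path_relator_path (s : ℕ) {a b c d : Quiver.Symmetrify V} (p : Quiver.Path a b)
    (q : Quiver.Path c d) :
    proj k _ s (ofPath k p * preprojectiveRelator k V * ofPath k q) =
      if p.length + 2 + q.length = s then
        ofPath k p * preprojectiveRelator k V * ofPath k q else 0 :=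
  proj_of_mem (mul_mem_piece (mul_mem_piece (ofPath_mem_piece p) relator_mem_piece)
    (ofPath_mem_piece q))

/-- The relator is homogeneous of degree `2`, so the ideal is homogeneous. -/
theorem mk_proj_eq_zero (s : ℕ) {x : PathAlgebra k (Quiver.Symmetrify V)} (hx : mk k V x = 0) :
    mk k V (proj k _ s x) = 0 := by
  refine map_eq_zero_of_mk_eq_zero' ((mk k V).toLinearMap ∘ₗ proj k _ s)
    (fun a b c d p q => ?_) hx
  simp only [LinearMap.comp_apply, proj_path_relator_path]
  split_ifs
  · simp [mk_relator]
  · simp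

/-- The class of an arrow of the double. -/
def ofHom (k : Type*) {V : Type*} [CommRing k] [Quiver V] [Fintype V]
    [∀ a b : V, Fintype (a ⟶ b)] {h j : Quiver.Symmetrify V} (β : h ⟶ j) :
    PreprojectiveAlgebra k V :=
  mk k V (ofPath k β.toPath)

/-- The idempotent of a vertex of the double. -/
def vertex (k : Type*) {V : Type*} [CommRing k] [Quiver V] [Fintype V]
    [∀ a b : V, Fintype (a ⟶ b)] (j : Quiver.Symmetrify V) : PreprojectiveAlgebra k V :=
  mk k V (PathAlgebra.idem k j)

/-- The ideal lives in degrees at least `2`, so the projection to degree `0` kills it but not the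
trivial path. -/
theorem vertex_ne_zero [Nontrivial k] (a : Quiver.Symmetrify V) : vertex k a ≠ 0 := by
  intro h
  have h1 := map_eq_zero_of_mk_eq_zero' (proj k _ 0) (fun a b c d p q => by
    rw [proj_path_relator_path, if_neg (by omega)]) h
  exact ofPath_ne_zero _ (((proj_ofPath 0 _).trans (if_pos rfl)).symm.trans h1)

theorem ofHom_mul_vertex {h j : Quiver.Symmetrify V} (β : h ⟶ j) :
    ofHom k β * vertex k j = ofHom k β :=
  (map_mul (mk k V) _ _).symm.trans (congrArg _ (ofPath_mul_idem _))

theorem vertex_mul_ofHom {h j : Quiver.Symmetrify V} (β : h ⟶ j) :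
    vertex k h * ofHom k β = ofHom k β :=
  (map_mul (mk k V) _ _).symm.trans (congrArg _ (idem_mul_ofPath _))

theorem mk_ofPath_mul_vertex {h j : Quiver.Symmetrify V} (p : Quiver.Path h j) :
    mk k V (ofPath k p) * vertex k j = mk k V (ofPath k p) :=
  (map_mul (mk k V) _ _).symm.trans (congrArg _ (ofPath_mul_idem _))

theorem mk_ofPath_mul_vertex_of_ne {h i j : Quiver.Symmetrify V} (p : Quiver.Path h i)
    (hij : i ≠ j) : mk k V (ofPath k p) * vertex k j = 0 :=
  ((map_mul (mk k V) _ _).symm.trans (congrArg _ (ofPath_mul_ofPath_of_ne k _ _ hij))).trans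
    (map_zero _)

theorem vertex_mul_vertex (j : Quiver.Symmetrify V) : vertex k j * vertex k j = vertex k j :=
  mk_ofPath_mul_vertex Quiver.Path.nil

theorem vertex_mul_vertex_of_ne {i j : Quiver.Symmetrify V} (h : i ≠ j) :
    vertex k i * vertex k j = 0 :=
  mk_ofPath_mul_vertex_of_ne Quiver.Path.nil h

theorem mul_mem_piece {m n : ℕ} {x y : PreprojectiveAlgebra k V} (hx : x ∈ piece k V m)
    (hy : y ∈ piece k V n) : x * y ∈ piece k V (m + n) := by
  obtain ⟨x, hx, rfl⟩ := hx
  obtain ⟨y, hy, rfl⟩ := hy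
  exact ⟨x * y, PathAlgebra.mul_mem_piece hx hy, map_mul (mk k V) x y⟩

theorem vertex_mem_piece (j : Quiver.Symmetrify V) : vertex k j ∈ piece k V 0 :=
  ⟨_, ofPath_mem_piece (Quiver.Path.nil : Quiver.Path j j), rfl⟩

theorem one_mem_piece : (1 : PreprojectiveAlgebra k V) ∈ piece k V 0 :=
  ⟨1, PathAlgebra.one_mem_piece, map_one (mk k V)⟩

theorem sum_vertex : ∑ j : Quiver.Symmetrify V, vertex k j = 1 := by
  rw [← map_one (mk k V), PathAlgebra.one_def, map_sum]
  rfl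

theorem ofHom_mem_piece {h j : Quiver.Symmetrify V} (β : h ⟶ j) : ofHom k β ∈ piece k V 1 :=
  ⟨_, ofPath_mem_piece β.toPath, rfl⟩

open Classical in
/-- The right deconcatenation of paths: a path that ends with the arrow `β` is mapped to the path
without its last arrow, placed in the component of `β`. -/
def dropLast : PathAlgebra k (Quiver.Symmetrify V) →ₗ[k]
    ((Σ j h : Quiver.Symmetrify V, (h ⟶ j)) → PreprojectiveAlgebra k V) :=
  PathAlgebra.lift fun _ _ p => match p with
    | Quiver.Path.nil => 0
    | Quiver.Path.cons (b := h) (c := j) p e => Pi.single ⟨j, h, e⟩ (mk k V (ofPath k p))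

open Classical in
theorem dropLast_mul_arrow {h j : Quiver.Symmetrify V} (x : PathAlgebra k (Quiver.Symmetrify V))
    (β : h ⟶ j) : dropLast (x * ofPath k β.toPath) =
      Pi.single ⟨j, h, β⟩ (mk k V x * vertex k h) := by
  have key : dropLast ∘ₗ LinearMap.mulRight k (ofPath k β.toPath) =
      LinearMap.single k (fun _ : Σ j h : Quiver.Symmetrify V, (h ⟶ j) =>
        PreprojectiveAlgebra k V) ⟨j, h, β⟩ ∘ₗ
        LinearMap.mulRight k (vertex k h) ∘ₗ (mk k V).toLinearMap := by
    refine hom_ext k fun a b p => ?_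
    simp only [LinearMap.comp_apply, LinearMap.mulRight_apply, AlgHom.toLinearMap_apply,
      LinearMap.single_apply]
    by_cases hb : b = h
    · subst hb
      rw [← ofPath_cons, mk_ofPath_mul_vertex]
      exact lift_ofPath _ _
    · rw [ofPath_mul_ofPath_of_ne k _ _ hb, mk_ofPath_mul_vertex_of_ne _ hb]
      simp
  exact LinearMap.congr_fun key x

/-- The map `x ↦ (± x β*)`. -/
def mulReverse : PreprojectiveAlgebra k V →ₗ[k]
    ((Σ j h : Quiver.Symmetrify V, (h ⟶ j)) → PreprojectiveAlgebra k V) :=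
  LinearMap.pi fun β => sign k β.2.2 • LinearMap.mulRight k (ofHom k (Quiver.reverse β.2.2))

theorem mulReverse_apply (x : PreprojectiveAlgebra k V)
    (β : Σ j h : Quiver.Symmetrify V, (h ⟶ j)) :
    mulReverse x β = sign k β.2.2 • (x * ofHom k (Quiver.reverse β.2.2)) := rfl

theorem dropLast_mul_relator (x : PathAlgebra k (Quiver.Symmetrify V)) :
    dropLast (x * preprojectiveRelator k V) = mulReverse (mk k V x) := by
  classical
  refine (congrArg (fun r => dropLast (x * r)) relator_eq).trans ?_
  rw [Finset.mul_sum, map_sum]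
  simp only [mul_smul_comm, map_smul, ← mul_assoc, dropLast_mul_arrow]
  ext β
  rw [mulReverse_apply, Finset.sum_apply, Finset.sum_eq_single β]
  · rw [Pi.smul_apply, map_mul, mul_assoc]
    erw [Pi.single_eq_same]
    rw [show mk k V (ofPath k (Quiver.reverse β.2.2).toPath) = ofHom k (Quiver.reverse β.2.2) from
      rfl, ofHom_mul_vertex]
  · intro γ _ hγ
    rw [Pi.smul_apply]
    erw [Pi.single_eq_of_ne (Ne.symm hγ)]
    exact smul_zero _
  · simp

theorem relator_mul_idem (j : Quiver.Symmetrify V) :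
    preprojectiveRelator k V * PathAlgebra.idem k j =
      PathAlgebra.idem k j * preprojectiveRelator k V := by
  rw [relator_eq, Finset.mul_sum, Finset.sum_mul]
  refine Finset.sum_congr rfl fun β _ => ?_
  rw [mul_smul_comm, smul_mul_assoc, ofPath_mul_ofPath]
  congr 1
  obtain ⟨i, h, β⟩ := β
  by_cases hi : i = j
  · subst hi
    rw [ofPath_mul_idem, idem_mul_ofPath]
  · rw [PathAlgebra.idem, ofPath_mul_ofPath_of_ne k _ _ hi,
      ofPath_mul_ofPath_of_ne k _ _ (Ne.symm hi)]

/-- The ideal is spanned by products `p r q`. If `q` ends with an arrow, deleting it leaves a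
multiple of `r`, zero in the quotient. If `q` is trivial, it commutes past `r`, and deleting the
last arrows of `r` gives the coefficients of a mesh relation. -/
theorem dropLast_mem_range {x : PathAlgebra k (Quiver.Symmetrify V)} (hx : mk k V x = 0) :
    dropLast x ∈ LinearMap.range (mulReverse (k := k) (V := V)) := by
  classical
  rw [← Submodule.Quotient.mk_eq_zero]
  refine map_eq_zero_of_mk_eq_zero' ((LinearMap.range mulReverse).mkQ ∘ₗ dropLast)
    (fun a b c d p q => ?_) hx
  rw [LinearMap.comp_apply, Submodule.mkQ_apply, Submodule.Quotient.mk_eq_zero]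
  cases q with
  | nil =>
    rw [← PathAlgebra.idem, mul_assoc, relator_mul_idem, ← mul_assoc, dropLast_mul_relator]
    exact LinearMap.mem_range_self _ _
  | cons q e =>
    rw [ofPath_cons, ← mul_assoc, dropLast_mul_arrow]
    simp [mk_relator]

/-- If a combination of arrows vanishes, then the coefficients come from the relations. -/
theorem exists_eq_mul_reverse (y : (Σ j h : Quiver.Symmetrify V, (h ⟶ j)) →
      PreprojectiveAlgebra k V)
    (hy : ∀ β, y β * vertex k β.2.1 = y β) (hsum : ∑ β, y β * ofHom k β.2.2 = 0) :
    ∃ x, ∀ β, y β = sign k β.2.2 • (x * ofHom k (Quiver.reverse β.2.2)) := by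
  classical
  choose Y hY using fun β => mk_surjective (y β)
  have h0 : mk k V (∑ β, Y β * ofPath k β.2.2.toPath) = 0 := by
    rw [map_sum, ← hsum]
    exact Finset.sum_congr rfl fun β _ => by rw [map_mul, hY]; rfl
  obtain ⟨x, hx⟩ := dropLast_mem_range h0
  refine ⟨x, fun β => ?_⟩
  rw [← mulReverse_apply, hx, map_sum, Finset.sum_apply, Finset.sum_eq_single β]
  · rw [dropLast_mul_arrow, hY, hy]
    erw [Pi.single_eq_same]
  · intro γ _ hγ
    rw [dropLast_mul_arrow]
    erw [Pi.single_eq_of_ne (Ne.symm hγ)]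
  · simp

/-- Homogeneity of the ideal allows the coefficient to be replaced by its component of degree `s`.
-/
theorem exists_mem_piece_eq_mul_reverse (s : ℕ) (y : (Σ j h : Quiver.Symmetrify V, (h ⟶ j)) →
      PreprojectiveAlgebra k V) (hs : ∀ β, y β ∈ piece k V (s + 1))
    (hy : ∀ β, y β * vertex k β.2.1 = y β) (hsum : ∑ β, y β * ofHom k β.2.2 = 0) :
    ∃ x ∈ piece k V s, ∀ β, y β = sign k β.2.2 • (x * ofHom k (Quiver.reverse β.2.2)) := by
  obtain ⟨x, hx⟩ := exists_eq_mul_reverse y hy hsum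
  obtain ⟨X, rfl⟩ := mk_surjective x
  refine ⟨mk k V (proj k _ s X), ⟨_, proj_mem s X, rfl⟩, fun β => ?_⟩
  obtain ⟨Y, hY, hYy⟩ := hs β
  have h0 : mk k V (Y - sign k β.2.2 • (X * ofPath k (Quiver.reverse β.2.2).toPath)) = 0 := by
    rw [map_sub, map_smul, map_mul, sub_eq_zero]
    exact hYy.trans (hx β)
  have h1 := mk_proj_eq_zero (s + 1) h0
  rw [map_sub, map_smul, proj_mul_arrow, proj_of_mem hY, if_pos rfl, map_sub, map_smul, map_mul,
    sub_eq_zero] at h1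
  exact hYy.symm.trans h1

/-- There are no relations in degree one: a product ending with an arrow has no component of degree
`0`. -/
theorem eq_zero_of_sum_mul_ofHom (y : (Σ j h : Quiver.Symmetrify V, (h ⟶ j)) →
      PreprojectiveAlgebra k V) (hs : ∀ β, y β ∈ piece k V 0)
    (hy : ∀ β, y β * vertex k β.2.1 = y β) (hsum : ∑ β, y β * ofHom k β.2.2 = 0) :
    y = 0 := by
  obtain ⟨x, hx⟩ := exists_eq_mul_reverse y hy hsum
  obtain ⟨X, rfl⟩ := mk_surjective x
  ext β
  obtain ⟨Y, hY, hYy⟩ := hs β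
  have h0 : mk k V (Y - sign k β.2.2 • (X * ofPath k (Quiver.reverse β.2.2).toPath)) = 0 := by
    rw [map_sub, map_smul, map_mul, sub_eq_zero]
    exact hYy.trans (hx β)
  have h1 := mk_proj_eq_zero 0 h0
  rw [map_sub, map_smul, proj_zero_mul_arrow, proj_of_mem hY, if_pos rfl, smul_zero, sub_zero] at h1
  exact hYy.symm.trans h1

end Ring

end PreprojectiveAlgebra

end

noncomputable section

/-! ### Exactness of the mesh sequences -/

namespace PreprojectiveAlgebra

open PathAlgebra

section Local

variable {k V : Type*} [CommRing k] [Quiver V] [Fintype V] [∀ a b : V, Fintype (a ⟶ b)]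

theorem ofHom_ne_zero [Nontrivial k] {h j : Quiver.Symmetrify V} (β : h ⟶ j) :
    ofHom k β ≠ 0 := by
  intro h0
  have h1 := map_eq_zero_of_mk_eq_zero' (proj k _ 1) (fun a b c d p q => by
    rw [proj_path_relator_path, if_neg (by omega)]) h0
  exact ofPath_ne_zero _ (((proj_ofPath 1 _).trans (if_pos rfl)).symm.trans h1)

theorem ofHom_mul_vertex_of_ne {h i j : Quiver.Symmetrify V} (β : h ⟶ i) (hij : i ≠ j) :
    ofHom k β * vertex k j = 0 :=
  mk_ofPath_mul_vertex_of_ne β.toPath hij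

/-- The preprojective relation at the vertex `j`. -/
theorem sum_sign_smul_eq_zero (j : Quiver.Symmetrify V) :
    ∑ p : Σ h : Quiver.Symmetrify V, (h ⟶ j),
      sign k p.2 • (ofHom k (Quiver.reverse p.2) * ofHom k p.2) = 0 := by
  have h1 : mk k V (preprojectiveRelator k V) * vertex k j = 0 := by
    rw [mk_relator, zero_mul]
  have h2 : mk k V (preprojectiveRelator k V) = ∑ β : Σ j h : Quiver.Symmetrify V, (h ⟶ j),
      sign k β.2.2 • (ofHom k (Quiver.reverse β.2.2) * ofHom k β.2.2) := by
    refine (congrArg (mk k V) relator_eq).trans ?_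
    simp only [map_sum, map_smul, map_mul]
    rfl
  rw [h2, Finset.sum_mul, Fintype.sum_sigma, Finset.sum_eq_single j] at h1
  · rw [← h1]
    refine Finset.sum_congr rfl fun p _ => ?_
    rw [smul_mul_assoc, mul_assoc, ofHom_mul_vertex]
  · intro i _ hi
    refine Finset.sum_eq_zero fun p _ => ?_
    rw [smul_mul_assoc, mul_assoc, ofHom_mul_vertex_of_ne _ hi, mul_zero, smul_zero]
  · simp

open Classical in
/-- Extension by zero of a family indexed by the arrows with target `j`. -/
def extendByZero (j : Quiver.Symmetrify V)
    (y : (Σ h : Quiver.Symmetrify V, (h ⟶ j)) → PreprojectiveAlgebra k V) :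
    (Σ j h : Quiver.Symmetrify V, (h ⟶ j)) → PreprojectiveAlgebra k V :=
  fun β => if hj : β.1 = j then y ⟨β.2.1, hj ▸ β.2.2⟩ else 0

theorem extendByZero_self (j : Quiver.Symmetrify V)
    (y : (Σ h : Quiver.Symmetrify V, (h ⟶ j)) → PreprojectiveAlgebra k V)
    (p : Σ h : Quiver.Symmetrify V, (h ⟶ j)) : extendByZero j y ⟨j, p⟩ = y p :=
  dif_pos rfl

theorem extendByZero_cases {P : PreprojectiveAlgebra k V → Quiver.Symmetrify V → Prop}
    (hP : ∀ h, P 0 h) (j : Quiver.Symmetrify V)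
    {y : (Σ h : Quiver.Symmetrify V, (h ⟶ j)) → PreprojectiveAlgebra k V}
    (hy : ∀ p, P (y p) p.1) (β : Σ j h : Quiver.Symmetrify V, (h ⟶ j)) :
    P (extendByZero j y β) β.2.1 := by
  obtain ⟨i, h, β⟩ := β
  by_cases hi : i = j
  · subst hi
    rw [extendByZero_self]
    exact hy ⟨h, β⟩
  · rw [show extendByZero j y ⟨i, h, β⟩ = 0 from dif_neg hi]
    exact hP h

theorem sum_extendByZero (j : Quiver.Symmetrify V)
    (y : (Σ h : Quiver.Symmetrify V, (h ⟶ j)) → PreprojectiveAlgebra k V) :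
    ∑ β, extendByZero j y β * ofHom k β.2.2 = ∑ p, y p * ofHom k p.2 := by
  rw [Fintype.sum_sigma, Finset.sum_eq_single j]
  · simp only [extendByZero_self]
  · intro i _ hi
    refine Finset.sum_eq_zero fun p _ => ?_
    rw [show extendByZero j y ⟨i, p⟩ = 0 from dif_neg hi, zero_mul]
  · simp

/-- Exactness at a single vertex. The coefficient may be multiplied by `e_j`, since the reversed
arrows start at `j`. -/
theorem exists_mul_reverse_of_sum_eq_zero (s : ℕ) (j : Quiver.Symmetrify V)
    (y : (Σ h : Quiver.Symmetrify V, (h ⟶ j)) → PreprojectiveAlgebra k V)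
    (hs : ∀ p, y p ∈ piece k V (s + 1)) (hy : ∀ p, y p * vertex k p.1 = y p)
    (hsum : ∑ p, y p * ofHom k p.2 = 0) :
    ∃ x ∈ piece k V s, x * vertex k j = x ∧
      ∀ p, y p = sign k p.2 • (x * ofHom k (Quiver.reverse p.2)) := by
  have h1 := extendByZero_cases (P := fun z _ => z ∈ piece k V (s + 1)) (fun _ => zero_mem _) j hs
  have h2 := extendByZero_cases (P := fun z h => z * vertex k h = z) (fun _ => zero_mul _) j hy
  have h3 := (sum_extendByZero j y).trans hsum
  obtain ⟨x, hx, hxy⟩ := exists_mem_piece_eq_mul_reverse s (extendByZero j y) h1 h2 h3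
  have h4 : x * vertex k j ∈ piece k V (s + 0) := mul_mem_piece hx (vertex_mem_piece j)
  refine ⟨x * vertex k j, h4, ?_, fun p => ?_⟩
  · rw [mul_assoc, vertex_mul_vertex]
  · rw [mul_assoc, vertex_mul_ofHom]
    exact (extendByZero_self j y p).symm.trans (hxy ⟨j, p⟩)

theorem eq_zero_of_sum_eq_zero (j : Quiver.Symmetrify V)
    (y : (Σ h : Quiver.Symmetrify V, (h ⟶ j)) → PreprojectiveAlgebra k V)
    (hs : ∀ p, y p ∈ piece k V 0) (hy : ∀ p, y p * vertex k p.1 = y p)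
    (hsum : ∑ p, y p * ofHom k p.2 = 0) (p : Σ h : Quiver.Symmetrify V, (h ⟶ j)) : y p = 0 := by
  have := eq_zero_of_sum_mul_ofHom (extendByZero j y)
    (extendByZero_cases (P := fun z _ => z ∈ piece k V 0) (fun _ => zero_mem _) j hs)
    (extendByZero_cases (P := fun z h => z * vertex k h = z) (fun _ => zero_mul _) j hy)
    (by rw [sum_extendByZero, hsum])
  rw [← extendByZero_self j y p, this]
  rfl

theorem exists_eq_smul_vertex {x : PreprojectiveAlgebra k V} (hx : x ∈ piece k V 0)
    (j : Quiver.Symmetrify V) (hj : x * vertex k j = x) :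
    ∃ c : k, x = c • vertex k j := by
  suffices h : x * vertex k j ∈ Submodule.span k {vertex k j} by
    rw [hj] at h
    obtain ⟨c, hc⟩ := Submodule.mem_span_singleton.1 h
    exact ⟨c, hc.symm⟩
  clear hj
  obtain ⟨X, hX, rfl⟩ := hx
  induction hX using Submodule.span_induction with
  | mem X h =>
    obtain ⟨a, b, p, hp, rfl⟩ := h
    cases p with
    | cons p e => simp at hp
    | nil =>
      by_cases ha : a = j
      · subst ha
        rw [AlgHom.toLinearMap_apply, mk_ofPath_mul_vertex]
        exact Submodule.mem_span_singleton_self _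
      · rw [AlgHom.toLinearMap_apply, mk_ofPath_mul_vertex_of_ne _ ha]
        exact zero_mem _
  | zero => simp
  | add X Y _ _ hX hY => rw [map_add, add_mul]; exact add_mem hX hY
  | smul c X _ hX => rw [map_smul, smul_mul_assoc]; exact Submodule.smul_mem _ _ hX

theorem sign_ne_zero [Nontrivial k] {h j : Quiver.Symmetrify V} (β : h ⟶ j) : sign k β ≠ 0 := by
  change (@Quiver.Hom V _ h j) ⊕ (@Quiver.Hom V _ j h) at β
  cases β
  · exact neg_ne_zero.2 one_ne_zero
  · exact one_ne_zero

end Local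

section Exactness

variable {k V : Type*} [Field k] [Quiver V] [Fintype V] [∀ a b : V, Fintype (a ⟶ b)]

/-- The submodules `S j s` are the spaces `q A_s e_j`, for an idempotent `q` of degree zero. -/
structure IsComponentFamily (S : Quiver.Symmetrify V → ℕ → Submodule k (PreprojectiveAlgebra k V))
    (q : PreprojectiveAlgebra k V) : Prop where
  mem_iff : ∀ j s x, x ∈ S j s ↔ x ∈ piece k V s ∧ x * vertex k j = x ∧ q * x = x
  mem_piece : q ∈ piece k V 0
  mul_self : q * q = q

namespace IsComponentFamily

variable {S : Quiver.Symmetrify V → ℕ → Submodule k (PreprojectiveAlgebra k V)}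
  {q : PreprojectiveAlgebra k V}

theorem mul_ofHom_mem (H : IsComponentFamily S q) {h j : Quiver.Symmetrify V} (β : h ⟶ j) (s : ℕ)
    (x : PreprojectiveAlgebra k V) (hx : x ∈ S h s) :
    LinearMap.mulRight k (ofHom k β) x ∈ S j (s + 1) := by
  rw [H.mem_iff] at hx ⊢
  obtain ⟨h1, -, h3⟩ := hx
  rw [LinearMap.mulRight_apply]
  exact ⟨mul_mem_piece h1 (ofHom_mem_piece β), by rw [mul_assoc, ofHom_mul_vertex],
    by rw [← mul_assoc, h3]⟩

/-- Right multiplication by an arrow. -/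
def arrowMap (H : IsComponentFamily S q) {h j : Quiver.Symmetrify V} (β : h ⟶ j) (s : ℕ) :
    S h s →ₗ[k] S j (s + 1) :=
  (LinearMap.mulRight k (ofHom k β)).restrict (H.mul_ofHom_mem β s)

theorem coe_incoming (H : IsComponentFamily S q) (j : Quiver.Symmetrify V) (s : ℕ)
    (y : ∀ p : Σ h : Quiver.Symmetrify V, (h ⟶ j), S p.1 s) :
    (Mesh.incoming (W := fun j s => S j s) (fun β s => H.arrowMap β s) j s y :
      PreprojectiveAlgebra k V) = ∑ p, (y p : PreprojectiveAlgebra k V) * ofHom k p.2 := by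
  rw [Mesh.incoming_apply, AddSubmonoidClass.coe_finsetSum]
  rfl

theorem surjective_incoming (H : IsComponentFamily S q) (j : Quiver.Symmetrify V) (s : ℕ) :
    Function.Surjective (Mesh.incoming (W := fun j s => S j s) (fun β s => H.arrowMap β s) j s) := by
  classical
  rintro ⟨x, hx⟩
  -- The paths occurring in `x` need not lie in `S`. Inserting `q` and `e_j` gives a claim about
  -- arbitrary elements of `A_{s+1}`, which can be checked on paths.
  suffices h : q * x * vertex k j ∈
      (LinearMap.range (Mesh.incoming (W := fun j s => S j s)
        (fun β s => H.arrowMap β s) j s)).map (S j (s + 1)).subtype by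
    obtain ⟨_, ⟨y, rfl⟩, hy⟩ := h
    refine ⟨y, Subtype.ext ?_⟩
    rw [H.mem_iff] at hx
    rw [hx.2.2, hx.2.1] at hy
    exact hy
  obtain ⟨⟨X, hX, rfl⟩, -⟩ := (H.mem_iff _ _ _).1 hx
  clear hx
  induction hX using Submodule.span_induction with
  | mem X h =>
    obtain ⟨a, b, p, hp, rfl⟩ := h
    cases p with
    | nil => simp at hp
    | @cons h _ p e =>
      by_cases hb : b = j
      · subst hb
        have hp' : p.length = s := by simpa using hp
        have hmem : q * PreprojectiveAlgebra.mk k V (ofPath k p) ∈ S h s := by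
          rw [H.mem_iff, mul_assoc, mk_ofPath_mul_vertex, ← mul_assoc, H.mul_self]
          refine ⟨?_, rfl, rfl⟩
          rw [← zero_add s]
          exact mul_mem_piece H.mem_piece ⟨_, hp' ▸ ofPath_mem_piece p, rfl⟩
        refine ⟨_, ⟨Pi.single (⟨h, e⟩ : Σ h : Quiver.Symmetrify V, (h ⟶ b)) ⟨_, hmem⟩, rfl⟩, ?_⟩
        rw [Submodule.subtype_apply, H.coe_incoming, Finset.sum_eq_single ⟨h, e⟩]
        · rw [Pi.single_eq_same, AlgHom.toLinearMap_apply, ofPath_cons, map_mul]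
          change q * PreprojectiveAlgebra.mk k V (ofPath k p) * ofHom k e =
            q * (PreprojectiveAlgebra.mk k V (ofPath k p) * ofHom k e) * vertex k b
          rw [← mul_assoc q, mul_assoc _ _ (vertex k b), ofHom_mul_vertex]
        · intro γ _ hγ
          rw [Pi.single_eq_of_ne hγ]
          simp
        · simp
      · rw [AlgHom.toLinearMap_apply, mul_assoc, mk_ofPath_mul_vertex_of_ne _ hb, mul_zero]
        exact zero_mem _
  | zero => simp
  | add X Y _ _ hX hY => rw [map_add, mul_add, add_mul]; exact add_mem hX hY
  | smul c X _ hX =>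
    rw [map_smul, mul_smul_comm, smul_mul_assoc]
    exact Submodule.smul_mem _ _ hX

theorem isRightExact (H : IsComponentFamily S q) :
    Mesh.IsRightExact (W := fun j s => S j s) (fun β s => H.arrowMap β s) (fun β => sign k β) where
  ne_zero := sign_ne_zero
  surjective := H.surjective_incoming
  injective j := by
    rw [injective_iff_map_eq_zero]
    intro y hy
    have hy' := congrArg Subtype.val hy
    rw [H.coe_incoming] at hy'
    ext p
    have hm := fun p => (H.mem_iff _ _ _).1 (y p).2
    exact eq_zero_of_sum_eq_zero j (fun p => (y p : PreprojectiveAlgebra k V))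
      (fun p => (hm p).1) (fun p => (hm p).2.1) hy' p
  exact j s := by
    intro y
    constructor
    · intro hy
      have hy' := congrArg Subtype.val hy
      rw [H.coe_incoming] at hy'
      have hm := fun p => (H.mem_iff _ _ _).1 (y p).2
      obtain ⟨x, hx, hxj, hxy⟩ := exists_mul_reverse_of_sum_eq_zero s j
        (fun p => (y p : PreprojectiveAlgebra k V)) (fun p => (hm p).1) (fun p => (hm p).2.1) hy'
      -- The coefficient `x` need not be fixed by `q`, but `q x` is, and it works because every `y
      -- p` is fixed by `q`.
      refine ⟨⟨q * x, (H.mem_iff _ _ _).2 ⟨?_, by rw [mul_assoc, hxj],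
        by rw [← mul_assoc, H.mul_self]⟩⟩, ?_⟩
      · rw [← zero_add s]
        exact mul_mem_piece H.mem_piece hx
      · ext p
        refine Eq.trans ?_ (hm p).2.2
        rw [hxy p]
        refine Eq.trans ?_ (mul_smul_comm _ _ _).symm
        exact congrArg (sign k p.2 • ·) (mul_assoc q x _)
    · rintro ⟨x, rfl⟩
      apply Subtype.ext
      rw [H.coe_incoming]
      have : ∀ p : Σ h : Quiver.Symmetrify V, (h ⟶ j),
          ((Mesh.outgoing (W := fun j s => S j s) (fun β s => H.arrowMap β s)
            (fun β => sign k β) j s x p : S p.1 (s + 1)) : PreprojectiveAlgebra k V) * ofHom k p.2 =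
          x * (sign k p.2 • (ofHom k (Quiver.reverse p.2) * ofHom k p.2)) := by
        intro p
        rw [mul_smul_comm, ← mul_assoc, ← smul_mul_assoc]
        rfl
      rw [Finset.sum_congr rfl fun p _ => this p, ← Finset.mul_sum, sum_sign_smul_eq_zero, mul_zero]
      rfl

theorem finite (H : IsComponentFamily S q) (j : Quiver.Symmetrify V) (s : ℕ) :
    Module.Finite k (S j s) := by
  induction s generalizing j with
  | zero =>
    have : S j 0 ≤ Submodule.span k {vertex k j} := by
      intro x hx
      rw [H.mem_iff] at hx
      obtain ⟨c, rfl⟩ := exists_eq_smul_vertex hx.1 j hx.2.1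
      exact Submodule.smul_mem _ _ (Submodule.mem_span_singleton_self _)
    exact Submodule.finiteDimensional_of_le this
  | succ s ih =>
    have : ∀ p : Σ h : Quiver.Symmetrify V, (h ⟶ j), Module.Finite k (S p.1 s) := fun p => ih p.1
    exact Module.Finite.of_surjective _ (H.surjective_incoming j s)

end IsComponentFamily

/-- The space `e_i A_s e_j`. -/
def corner (i j : Quiver.Symmetrify V) (s : ℕ) : Submodule k (PreprojectiveAlgebra k V) :=
  piece k V s ⊓ (LinearMap.ker (LinearMap.mulRight k (vertex k j) - LinearMap.id) ⊓
    LinearMap.ker (LinearMap.mulLeft k (vertex k i) - LinearMap.id))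

/-- The choice `q = e_i` leaves only `k e_i` in degree `0`, as the injectivity argument needs; with
`q = 1` each vertex would have its own independent scalar there. -/
theorem isComponentFamily_corner (i : Quiver.Symmetrify V) :
    IsComponentFamily (corner (k := k) i) (vertex k i) where
  mem_iff j s x := by simp [corner, sub_eq_zero]
  mem_piece := vertex_mem_piece i
  mul_self := vertex_mul_vertex i

/-- The choice `q = 1` gives the spaces on which the traces are taken. -/
theorem isComponentFamily_leftPiece :
    IsComponentFamily (k := k) (V := V) (leftPiece (piece k V) (vertex k)) 1 where
  mem_iff j s x := by
    simp only [one_mul, and_true]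
    constructor
    · rintro ⟨x, hx, rfl⟩
      have h4 : x * vertex k j ∈ piece k V (s + 0) := mul_mem_piece hx (vertex_mem_piece j)
      refine ⟨h4, ?_⟩
      rw [LinearMap.mulRight_apply, mul_assoc, vertex_mul_vertex]
    · rintro ⟨hx, hj⟩
      exact ⟨x, hx, hj⟩
  mem_piece := one_mem_piece
  mul_self := mul_one 1

theorem corner_zero_eq_smul {i : Quiver.Symmetrify V}
    (f : ∀ j : Quiver.Symmetrify V, corner (k := k) i j 0 →ₗ[k] corner (k := k) i j 0) :
    ∃ c : k, ∀ j x, f j x = c • x := by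
  classical
  have hi : vertex k i ∈ corner (k := k) i i 0 := by
    rw [(isComponentFamily_corner i).mem_iff]
    exact ⟨vertex_mem_piece i, vertex_mul_vertex i, vertex_mul_vertex i⟩
  have h1 := ((isComponentFamily_corner i).mem_iff _ _ _).1 (f i ⟨_, hi⟩).2
  obtain ⟨c, hc⟩ := exists_eq_smul_vertex h1.1 i h1.2.1
  refine ⟨c, ?_⟩
  rintro j ⟨x, hx⟩
  have h2 := ((isComponentFamily_corner i).mem_iff _ _ _).1 hx
  obtain ⟨d, rfl⟩ := exists_eq_smul_vertex h2.1 j h2.2.1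
  by_cases hj : i = j
  · subst hj
    have : (⟨d • vertex k i, hx⟩ : corner (k := k) i i 0) = d • ⟨vertex k i, hi⟩ := rfl
    rw [this, map_smul, smul_comm c d]
    congr 1
    exact Subtype.ext hc
  · have h3 := h2.2.2
    rw [mul_smul_comm, vertex_mul_vertex_of_ne hj, smul_zero] at h3
    have : (⟨d • vertex k j, hx⟩ : corner (k := k) i j 0) = 0 := Subtype.ext h3.symm
    rw [this, map_zero, smul_zero]

/-- If the quiver has a positive additive function, then the right multiplications by the
arrows have no common kernel. -/
theorem eq_zero_of_mul_ofHom_eq_zero {δ : Quiver.Symmetrify V → ℕ}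
    (hδ : ∀ h : Quiver.Symmetrify V, ∑ j, Fintype.card (h ⟶ j) * δ j = 2 * δ h)
    (hpos : ∀ j, 0 < δ j) {s : ℕ} {x : PreprojectiveAlgebra k V} (hx : x ∈ piece k V s)
    (j : Quiver.Symmetrify V) (hj : x * vertex k j = x)
    (h0 : ∀ (h : Quiver.Symmetrify V) (β : j ⟶ h), x * ofHom k β = 0) : x = 0 := by
  -- Decompose `x = ∑ e_i x`; each summand lies in a family whose degree zero part has only scalar
  -- endomorphisms.
  rw [← one_mul x, ← sum_vertex, Finset.sum_mul]
  refine Finset.sum_eq_zero fun i _ => ?_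
  have H := isComponentFamily_corner (k := k) i
  have hfin := H.finite
  have hi : vertex k i ∈ corner (k := k) i i 0 := by
    rw [H.mem_iff]
    exact ⟨vertex_mem_piece i, vertex_mul_vertex i, vertex_mul_vertex i⟩
  have hw : 0 < Mesh.weight k (fun j s => corner (k := k) i j s) δ 0 := by
    have : Module.Finite k (corner (k := k) i i 0) := hfin i 0
    have : Nontrivial (corner (k := k) i i 0) :=
      ⟨⟨⟨_, hi⟩, 0, fun h => vertex_ne_zero i (congrArg Subtype.val h)⟩⟩
    refine Finset.sum_pos' (fun _ _ => Nat.zero_le _) ⟨i, Finset.mem_univ _, ?_⟩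
    exact Nat.mul_pos (hpos i) Module.finrank_pos
  have hinj := H.isRightExact.outgoing_injective hδ corner_zero_eq_smul hw s j
  have hmem : vertex k i * x ∈ corner (k := k) i j s := by
    rw [H.mem_iff, mul_assoc, hj, ← mul_assoc, vertex_mul_vertex]
    refine ⟨?_, rfl, rfl⟩
    rw [← zero_add s]
    exact mul_mem_piece (vertex_mem_piece i) hx
  have := hinj (a₁ := ⟨_, hmem⟩) (a₂ := 0) (by
    rw [map_zero]
    ext p
    change sign k p.2 • (vertex k i * x * ofHom k (Quiver.reverse p.2)) = 0
    rw [mul_assoc, h0, mul_zero, smul_zero])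
  exact congrArg Subtype.val this

end Exactness

end PreprojectiveAlgebra

end

noncomputable section

/-! ### Traces along the mesh sequences -/

namespace PreprojectiveAlgebra

open PathAlgebra

section Trace

variable {k V : Type*} [Field k] [Quiver V] [Fintype V] [∀ a b : V, Fintype (a ⟶ b)]

instance finite_leftPiece (j : Quiver.Symmetrify V) (s : ℕ) :
    Module.Finite k (leftPiece (piece k V) (vertex k) j s) :=
  isComponentFamily_leftPiece.finite j s

variable {g : PreprojectiveAlgebra k V ≃ₐ[k] PreprojectiveAlgebra k V}
  {γ : ∀ {h j : Quiver.Symmetrify V}, (h ⟶ j) → k}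

/-- An automorphism that scales the arrows scales the relation at every vertex. -/
theorem exists_mul_reverse_eq
    (hγ : ∀ {h j : Quiver.Symmetrify V} (β : h ⟶ j), g (ofHom k β) = γ β • ofHom k β)
    (j : Quiver.Symmetrify V) :
    ∃ μ : k, ∀ (h : Quiver.Symmetrify V) (β : h ⟶ j), γ β * γ (Quiver.reverse β) = μ := by
  have h1 : ∀ p : Σ h : Quiver.Symmetrify V, (h ⟶ j),
      g (sign k p.2 • (ofHom k (Quiver.reverse p.2) * ofHom k p.2)) =
      ((sign k p.2 * (γ p.2 * γ (Quiver.reverse p.2))) • ofHom k (Quiver.reverse p.2)) *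
        ofHom k p.2 := by
    intro p
    rw [map_smul, map_mul, hγ, hγ, smul_mul_assoc, mul_smul_comm, smul_mul_assoc, smul_smul,
      smul_smul]
    congr 1
    ring
  -- The image of the relation at `j` is again a relation of degree two ending at `j`. By exactness
  -- its coefficients come from an element of `A_0 e_j = k e_j`, that is, from a scalar `μ`.
  have h2 := congrArg g (sum_sign_smul_eq_zero (k := k) j)
  rw [map_sum, map_zero, Finset.sum_congr rfl fun p _ => h1 p] at h2
  obtain ⟨x, hx, hxj, hxy⟩ := exists_mul_reverse_of_sum_eq_zero 0 j
    (fun p => (sign k p.2 * (γ p.2 * γ (Quiver.reverse p.2))) • ofHom k (Quiver.reverse p.2))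
    (fun p => Submodule.smul_mem _ _ (ofHom_mem_piece _))
    (fun p => by rw [smul_mul_assoc, ofHom_mul_vertex]) h2
  obtain ⟨μ, rfl⟩ := exists_eq_smul_vertex hx j hxj
  refine ⟨μ, fun h β => ?_⟩
  have h3 := hxy ⟨h, β⟩
  dsimp only at h3
  rw [smul_mul_assoc, vertex_mul_ofHom, smul_smul] at h3
  exact mul_left_cancel₀ (sign_ne_zero β) (smul_left_injective k (ofHom_ne_zero _) h3)

variable (hg : IsGradedAut (piece k V) g)
  (he : ∀ i : Quiver.Symmetrify V, g (vertex k i) = vertex k i)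

/-- The automorphism induced on `A_s e_j`. -/
def restrictLeftPiece (j : Quiver.Symmetrify V) (s : ℕ) :
    leftPiece (piece k V) (vertex k) j s →ₗ[k] leftPiece (piece k V) (vertex k) j s :=
  g.toLinearMap.restrict (mapsTo_leftPiece hg he j s)

theorem restrictLeftPiece_arrowMap
    (hγ : ∀ {h j : Quiver.Symmetrify V} (β : h ⟶ j), g (ofHom k β) = γ β • ofHom k β)
    {h j : Quiver.Symmetrify V} (β : h ⟶ j) (s : ℕ) (x : leftPiece (piece k V) (vertex k) h s) :
    restrictLeftPiece hg he j (s + 1) (isComponentFamily_leftPiece.arrowMap β s x) =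
      γ β • isComponentFamily_leftPiece.arrowMap β s (restrictLeftPiece hg he h s x) := by
  apply Subtype.ext
  change g (x * ofHom k β) = γ β • (g x * ofHom k β)
  rw [map_mul, hγ, mul_smul_comm]

/-- The action on the middle terms of the mesh sequences. -/
def scaledPi (γ : ∀ {h j : Quiver.Symmetrify V}, (h ⟶ j) → k) (j : Quiver.Symmetrify V) (s : ℕ) :
    (∀ p : Σ h : Quiver.Symmetrify V, (h ⟶ j), leftPiece (piece k V) (vertex k) p.1 s) →ₗ[k]
      (∀ p : Σ h : Quiver.Symmetrify V, (h ⟶ j), leftPiece (piece k V) (vertex k) p.1 s) :=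
  LinearMap.piMap fun p => γ p.2 • restrictLeftPiece hg he p.1 s

theorem trace_scaledPi (j : Quiver.Symmetrify V) (s : ℕ) :
    LinearMap.trace k _ (scaledPi hg he γ j s) =
      ∑ p : Σ h : Quiver.Symmetrify V, (h ⟶ j),
        γ p.2 * LinearMap.trace k _ (restrictLeftPiece hg he p.1 s) := by
  rw [scaledPi, LinearMap.trace_piMap]
  simp only [map_smul, smul_eq_mul]

theorem incoming_scaledPi
    (hγ : ∀ {h j : Quiver.Symmetrify V} (β : h ⟶ j), g (ofHom k β) = γ β • ofHom k β)
    (j : Quiver.Symmetrify V) (s : ℕ) :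
    Mesh.incoming (W := fun j s => leftPiece (piece k V) (vertex k) j s)
        (fun β s => isComponentFamily_leftPiece.arrowMap β s) j s ∘ₗ scaledPi hg he γ j s =
      restrictLeftPiece hg he j (s + 1) ∘ₗ
        Mesh.incoming (W := fun j s => leftPiece (piece k V) (vertex k) j s)
          (fun β s => isComponentFamily_leftPiece.arrowMap β s) j s := by
  refine LinearMap.ext fun y => ?_
  rw [LinearMap.comp_apply, LinearMap.comp_apply, Mesh.incoming_apply, Mesh.incoming_apply, map_sum]
  refine Finset.sum_congr rfl fun p _ => ?_
  rw [restrictLeftPiece_arrowMap hg he hγ]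
  exact (isComponentFamily_leftPiece.arrowMap p.2 s).map_smul _ _

theorem trace_restrictLeftPiece_zero (j : Quiver.Symmetrify V) :
    LinearMap.trace k _ (restrictLeftPiece hg he j 0) = 1 := by
  have hj : vertex k j ∈ leftPiece (piece k V) (vertex k) j 0 :=
    (isComponentFamily_leftPiece.mem_iff _ _ _).2
      ⟨vertex_mem_piece j, vertex_mul_vertex j, one_mul _⟩
  have h1 : ∀ x : leftPiece (piece k V) (vertex k) j 0, ∃ c : k, c • ⟨vertex k j, hj⟩ = x := by
    rintro ⟨x, hx⟩
    have h2 := (isComponentFamily_leftPiece.mem_iff _ _ _).1 hx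
    obtain ⟨c, hc⟩ := exists_eq_smul_vertex h2.1 j h2.2.1
    exact ⟨c, Subtype.ext hc.symm⟩
  have h2 : restrictLeftPiece hg he j 0 = LinearMap.id := by
    refine LinearMap.ext fun x => ?_
    obtain ⟨c, rfl⟩ := h1 x
    rw [map_smul]
    refine congrArg (c • ·) (Subtype.ext ?_)
    exact he j
  rw [h2, LinearMap.trace_id, finrank_eq_one ⟨vertex k j, hj⟩ _ h1, Nat.cast_one]
  exact fun h => vertex_ne_zero j (congrArg Subtype.val h)

/-- In this degree `incoming` is an isomorphism, which conjugates the two actions. -/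
theorem trace_restrictLeftPiece_one
    (hγ : ∀ {h j : Quiver.Symmetrify V} (β : h ⟶ j), g (ofHom k β) = γ β • ofHom k β)
    (j : Quiver.Symmetrify V) :
    LinearMap.trace k _ (restrictLeftPiece hg he j 1) =
      ∑ p : Σ h : Quiver.Symmetrify V, (h ⟶ j),
        γ p.2 * LinearMap.trace k _ (restrictLeftPiece hg he p.1 0) := by
  have H := (isComponentFamily_leftPiece (k := k) (V := V)).isRightExact
  rw [← trace_scaledPi]
  let e := LinearEquiv.ofBijective _ ⟨H.injective j, H.surjective j 0⟩
  rw [← LinearMap.trace_conj' (scaledPi hg he γ j 0) e]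
  congr 1
  refine LinearMap.ext fun x => ?_
  obtain ⟨y, rfl⟩ := e.surjective x
  rw [LinearEquiv.conj_apply_apply, e.symm_apply_apply]
  exact (LinearMap.congr_fun (incoming_scaledPi hg he hγ j 0) y).symm

/-- The left term carries `μ g`: multiplication by `β*` contributes `γ(β*)`, and the action on the
summand of `β` contributes `γ(β)`. -/
theorem trace_restrictLeftPiece_add_two {δ : Quiver.Symmetrify V → ℕ}
    (hδ : ∀ h : Quiver.Symmetrify V, ∑ j, Fintype.card (h ⟶ j) * δ j = 2 * δ h)
    (hpos : ∀ j, 0 < δ j)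
    (hγ : ∀ {h j : Quiver.Symmetrify V} (β : h ⟶ j), g (ofHom k β) = γ β • ofHom k β)
    {μ : k} (hμ : ∀ {h j : Quiver.Symmetrify V} (β : h ⟶ j), γ β * γ (Quiver.reverse β) = μ)
    (j : Quiver.Symmetrify V) (s : ℕ) :
    μ * LinearMap.trace k _ (restrictLeftPiece hg he j s) +
      LinearMap.trace k _ (restrictLeftPiece hg he j (s + 2)) =
      ∑ p : Σ h : Quiver.Symmetrify V, (h ⟶ j),
        γ p.2 * LinearMap.trace k _ (restrictLeftPiece hg he p.1 (s + 1)) := by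
  have H := (isComponentFamily_leftPiece (k := k) (V := V)).isRightExact
  rw [← trace_scaledPi, ← smul_eq_mul, ← map_smul]
  refine (LinearMap.trace_of_exact ?_ (H.surjective j (s + 1)) (H.exact j s) ?_
    (incoming_scaledPi hg he hγ j (s + 1))).symm
  · rw [injective_iff_map_eq_zero]
    intro x hx
    have hm := (isComponentFamily_leftPiece.mem_iff _ _ _).1 x.2
    refine Subtype.ext (eq_zero_of_mul_ofHom_eq_zero hδ hpos hm.1 j hm.2.1 fun h β => ?_)
    have h1 := congrArg Subtype.val (congrFun hx ⟨h, Quiver.reverse β⟩)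
    change sign k (Quiver.reverse β) •
      ((x : PreprojectiveAlgebra k V) * ofHom k (Quiver.reverse (Quiver.reverse β))) = 0 at h1
    rw [Quiver.reverse_reverse] at h1
    exact (smul_eq_zero.1 h1).resolve_left (sign_ne_zero _)
  · refine LinearMap.ext fun x => funext fun p => Subtype.ext ?_
    change γ p.2 • g (sign k p.2 • ((x : PreprojectiveAlgebra k V) * ofHom k (Quiver.reverse p.2))) =
      sign k p.2 • ((μ • g x) * ofHom k (Quiver.reverse p.2))
    rw [map_smul, map_mul, hγ, mul_smul_comm, smul_mul_assoc, ← hμ p.2, smul_smul, smul_smul,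
      smul_smul]
    congr 1
    ring

/-- The mesh relation for the vector trace. -/
theorem upperVectorTrace_eq {δ : Quiver.Symmetrify V → ℕ}
    (hδ : ∀ h : Quiver.Symmetrify V, ∑ j, Fintype.card (h ⟶ j) * δ j = 2 * δ h)
    (hpos : ∀ j, 0 < δ j)
    (hγ : ∀ {h j : Quiver.Symmetrify V} (β : h ⟶ j), g (ofHom k β) = γ β • ofHom k β)
    {μ : k} (hμ : ∀ {h j : Quiver.Symmetrify V} (β : h ⟶ j), γ β * γ (Quiver.reverse β) = μ)
    (j : Quiver.Symmetrify V) :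
    (1 + PowerSeries.C μ * PowerSeries.X ^ 2) * upperVectorTrace hg he j -
      ∑ h : Quiver.Symmetrify V, (∑ β : h ⟶ j, PowerSeries.C (γ β) * PowerSeries.X) *
        upperVectorTrace hg he h = 1 := by
  have hT : ∀ j s, PowerSeries.coeff s (upperVectorTrace hg he j) =
      LinearMap.trace k _ (restrictLeftPiece hg he j s) := fun j s => PowerSeries.coeff_mk _ _
  have hS : ∑ h : Quiver.Symmetrify V, (∑ β : h ⟶ j, PowerSeries.C (γ β) * PowerSeries.X) *
      upperVectorTrace hg he h = PowerSeries.X * ∑ p : Σ h : Quiver.Symmetrify V, (h ⟶ j),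
        PowerSeries.C (γ p.2) * upperVectorTrace hg he p.1 := by
    rw [Fintype.sum_sigma, Finset.mul_sum]
    refine Finset.sum_congr rfl fun h _ => ?_
    rw [Finset.sum_mul, Finset.mul_sum]
    exact Finset.sum_congr rfl fun β _ => by ring
  have hX : (1 + PowerSeries.C μ * PowerSeries.X ^ 2) * upperVectorTrace hg he j =
      upperVectorTrace hg he j +
        PowerSeries.X * (PowerSeries.X * (PowerSeries.C μ * upperVectorTrace hg he j)) := by
    ring
  rw [hS, hX]
  ext s
  rw [map_sub, map_add, hT]
  -- The constant term is the trace on `k e_j`. In degree one the `X²` term is still absent; from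
  -- degree two on, the short exact sequence applies.
  match s with
  | 0 => simp [trace_restrictLeftPiece_zero]
  | 1 =>
    rw [PowerSeries.coeff_succ_X_mul, PowerSeries.coeff_succ_X_mul, PowerSeries.coeff_zero_X_mul,
      trace_restrictLeftPiece_one hg he hγ, map_sum]
    simp [PowerSeries.coeff_C_mul, hT, PowerSeries.coeff_one]
  | s + 2 =>
    rw [PowerSeries.coeff_succ_X_mul, PowerSeries.coeff_succ_X_mul, PowerSeries.coeff_succ_X_mul,
      map_sum, PowerSeries.coeff_C_mul, hT]
    simp only [PowerSeries.coeff_C_mul, hT]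
    rw [← trace_restrictLeftPiece_add_two hg he hδ hpos hγ hμ, PowerSeries.coeff_one,
      if_neg (by omega)]
    ring

end Trace

end PreprojectiveAlgebra

end

noncomputable section

/-! ### The anti-involution and the lower trace -/

theorem Quiver.Path.length_reverse {V : Type*} [Quiver V] [Quiver.HasReverse V] {a b : V}
    (p : Quiver.Path a b) : p.reverse.length = p.length := by
  induction p with
  | nil => rfl
  | cons p e ih =>
    rw [Quiver.Path.reverse, Quiver.Path.length_comp, ih, Quiver.Path.length_toPath,
      Quiver.Path.length_cons, add_comm]

namespace PathAlgebra

variable {k V : Type*} [CommRing k] [Quiver V] [Quiver.HasInvolutiveReverse V]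

/-- The reversal of paths. -/
def reverse : PathAlgebra k V →ₗ[k] PathAlgebra k V :=
  lift fun _ _ p => ofPath k p.reverse

theorem reverse_ofPath {a b : V} (p : Quiver.Path a b) :
    reverse (ofPath k p) = ofPath k p.reverse :=
  lift_ofPath _ _

theorem reverse_reverse (x : PathAlgebra k V) : reverse (reverse x) = x := by
  have key : (reverse ∘ₗ reverse : PathAlgebra k V →ₗ[k] PathAlgebra k V) = LinearMap.id := by
    refine hom_ext k fun a b p => ?_
    rw [LinearMap.comp_apply, reverse_ofPath, reverse_ofPath, Quiver.Path.reverse_reverse]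
    rfl
  exact LinearMap.congr_fun key x

theorem reverse_mem_piece {s : ℕ} {x : PathAlgebra k V} (hx : x ∈ piece k V s) :
    reverse x ∈ piece k V s := by
  induction hx using Submodule.span_induction with
  | mem x h =>
    obtain ⟨a, b, p, rfl, rfl⟩ := h
    rw [reverse_ofPath, ← p.length_reverse]
    exact ofPath_mem_piece _
  | zero => simp
  | add x y _ _ hx hy => rw [map_add]; exact add_mem hx hy
  | smul c x _ hx => rw [map_smul]; exact Submodule.smul_mem _ _ hx

variable [Fintype V]

theorem reverse_mul (x y : PathAlgebra k V) : reverse (x * y) = reverse y * reverse x := by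
  have h1 : ∀ {a b : V} (p : Quiver.Path a b) (y : PathAlgebra k V),
      reverse (ofPath k p * y) = reverse y * ofPath k p.reverse := by
    intro a b p y
    have key : reverse ∘ₗ LinearMap.mulLeft k (ofPath k p) =
        LinearMap.mulRight k (ofPath k p.reverse) ∘ₗ reverse := by
      refine hom_ext k fun c d q => ?_
      simp only [LinearMap.comp_apply, LinearMap.mulLeft_apply, LinearMap.mulRight_apply,
        reverse_ofPath]
      by_cases h : b = c
      · subst h
        rw [ofPath_mul_ofPath, ofPath_mul_ofPath, reverse_ofPath, Quiver.Path.reverse_comp]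
      · rw [ofPath_mul_ofPath_of_ne k _ _ h, ofPath_mul_ofPath_of_ne k _ _ (Ne.symm h), map_zero]
    exact LinearMap.congr_fun key y
  have key : reverse ∘ₗ LinearMap.mulRight k y = LinearMap.mulLeft k (reverse y) ∘ₗ reverse := by
    refine hom_ext k fun a b p => ?_
    simp only [LinearMap.comp_apply, LinearMap.mulLeft_apply, LinearMap.mulRight_apply,
      reverse_ofPath, h1]
  exact LinearMap.congr_fun key x

theorem reverse_one : reverse (1 : PathAlgebra k V) = 1 := by
  rw [one_def, map_sum]
  exact Finset.sum_congr rfl fun a _ => reverse_ofPath _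

/-- The reversal of paths as an anti-homomorphism. -/
def reverseHom : PathAlgebra k V →ₐ[k] (PathAlgebra k V)ᵐᵒᵖ :=
  AlgHom.ofLinearMap ((MulOpposite.opLinearEquiv k).toLinearMap ∘ₗ reverse)
    (congrArg MulOpposite.op reverse_one) fun x y => congrArg MulOpposite.op (reverse_mul x y)

end PathAlgebra

namespace PreprojectiveAlgebra

open PathAlgebra

variable {k V : Type*} [CommRing k] [Quiver V] [Fintype V] [∀ a b : V, Fintype (a ⟶ b)]

/-- Reversal fixes every term `β* β`. -/
theorem reverse_relator :
    PathAlgebra.reverse (preprojectiveRelator k V) = preprojectiveRelator k V := by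
  rw [relator_eq, map_sum]
  refine Finset.sum_congr rfl fun β _ => ?_
  rw [map_smul, PathAlgebra.reverse_mul, reverse_ofPath, reverse_ofPath,
    Quiver.Path.reverse_toPath, Quiver.Path.reverse_toPath, Quiver.reverse_reverse]

/-- The anti-homomorphism of the preprojective algebra that exchanges `α` and `α*`. -/
def reverseHom : PreprojectiveAlgebra k V →ₐ[k] (PreprojectiveAlgebra k V)ᵐᵒᵖ :=
  RingQuot.liftAlgHom k ⟨(AlgHom.op (mk k V)).comp PathAlgebra.reverseHom, by
    rintro _ _ ⟨rfl, rfl⟩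
    rw [map_zero]
    change MulOpposite.op (mk k V (PathAlgebra.reverse (preprojectiveRelator k V))) = 0
    rw [reverse_relator, mk_relator, MulOpposite.op_zero]⟩

/-- The anti-involution of the preprojective algebra that exchanges `α` and `α*`. -/
def reverse : PreprojectiveAlgebra k V →ₗ[k] PreprojectiveAlgebra k V :=
  (MulOpposite.opLinearEquiv k).symm.toLinearMap ∘ₗ reverseHom.toLinearMap

theorem reverse_mk (x : PathAlgebra k (Quiver.Symmetrify V)) :
    reverse (mk k V x) = mk k V (PathAlgebra.reverse x) :=
  congrArg MulOpposite.unop (RingQuot.liftAlgHom_mkAlgHom_apply k _ _ x)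

theorem reverse_reverse (x : PreprojectiveAlgebra k V) : reverse (reverse x) = x := by
  obtain ⟨x, rfl⟩ := mk_surjective x
  rw [reverse_mk, reverse_mk, PathAlgebra.reverse_reverse]

theorem reverse_mul (x y : PreprojectiveAlgebra k V) :
    reverse (x * y) = reverse y * reverse x :=
  congrArg MulOpposite.unop (map_mul reverseHom x y)

theorem reverse_one : reverse (1 : PreprojectiveAlgebra k V) = 1 :=
  congrArg MulOpposite.unop (map_one reverseHom)

theorem reverse_vertex (j : Quiver.Symmetrify V) : reverse (vertex k j) = vertex k j :=
  (reverse_mk _).trans (congrArg _ (reverse_ofPath _))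

theorem reverse_ofHom {h j : Quiver.Symmetrify V} (β : h ⟶ j) :
    reverse (ofHom k β) = ofHom k (Quiver.reverse β) :=
  (reverse_mk _).trans (congrArg _ (reverse_ofPath _))

theorem reverse_mem_piece {s : ℕ} {x : PreprojectiveAlgebra k V} (hx : x ∈ piece k V s) :
    reverse x ∈ piece k V s := by
  obtain ⟨X, hX, rfl⟩ := hx
  exact ⟨_, PathAlgebra.reverse_mem_piece hX, (reverse_mk X).symm⟩

/-- The anti-involution as a linear equivalence. -/
def reverseEquiv : PreprojectiveAlgebra k V ≃ₗ[k] PreprojectiveAlgebra k V :=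
  LinearEquiv.ofInvolutive reverse reverse_reverse

/-- The conjugate of an automorphism by the anti-involution. -/
def conjReverse (g : PreprojectiveAlgebra k V ≃ₐ[k] PreprojectiveAlgebra k V) :
    PreprojectiveAlgebra k V ≃ₐ[k] PreprojectiveAlgebra k V :=
  AlgEquiv.ofLinearEquiv (reverseEquiv.trans (g.toLinearEquiv.trans reverseEquiv))
    (by
      change reverse (g (reverse 1)) = 1
      rw [reverse_one, map_one, reverse_one])
    (fun x y => by
      change reverse (g (reverse (x * y))) = reverse (g (reverse x)) * reverse (g (reverse y))
      rw [reverse_mul, map_mul, reverse_mul])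

theorem conjReverse_apply (g : PreprojectiveAlgebra k V ≃ₐ[k] PreprojectiveAlgebra k V)
    (x : PreprojectiveAlgebra k V) : conjReverse g x = reverse (g (reverse x)) := rfl

theorem isGradedAut_conjReverse {k : Type*} [Field k]
    {g : PreprojectiveAlgebra k V ≃ₐ[k] PreprojectiveAlgebra k V}
    (hg : IsGradedAut (piece k V) g) : IsGradedAut (piece k V) (conjReverse g) := by
  intro s
  apply le_antisymm
  · rintro _ ⟨x, hx, rfl⟩
    have h : g (reverse x) ∈ (piece k V s).map g.toLinearMap := ⟨_, reverse_mem_piece hx, rfl⟩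
    rw [hg s] at h
    exact reverse_mem_piece h
  · intro x hx
    have h := reverse_mem_piece hx
    rw [← hg s] at h
    obtain ⟨y, hy, hyx⟩ := h
    refine ⟨reverse y, reverse_mem_piece hy, ?_⟩
    change reverse (g (reverse (reverse y))) = x
    rw [reverse_reverse, ← reverse_reverse x, ← hyx]
    rfl

section Pieces

variable {k : Type*} [Field k]

theorem reverse_mem_rightPiece {j : Quiver.Symmetrify V} {s : ℕ} {x : PreprojectiveAlgebra k V}
    (hx : x ∈ leftPiece (piece k V) (vertex k) j s) :
    reverse x ∈ rightPiece (piece k V) (vertex k) j s := by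
  obtain ⟨x, hx, rfl⟩ := hx
  refine ⟨reverse x, reverse_mem_piece hx, ?_⟩
  rw [LinearMap.mulLeft_apply, LinearMap.mulRight_apply, reverse_mul, reverse_vertex]

theorem reverse_mem_leftPiece {j : Quiver.Symmetrify V} {s : ℕ} {x : PreprojectiveAlgebra k V}
    (hx : x ∈ rightPiece (piece k V) (vertex k) j s) :
    reverse x ∈ leftPiece (piece k V) (vertex k) j s := by
  obtain ⟨x, hx, rfl⟩ := hx
  refine ⟨reverse x, reverse_mem_piece hx, ?_⟩
  rw [LinearMap.mulLeft_apply, LinearMap.mulRight_apply, reverse_mul, reverse_vertex]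

/-- The anti-involution identifies `A_s e_j` with `e_j A_s`. -/
def leftPieceEquiv (j : Quiver.Symmetrify V) (s : ℕ) :
    leftPiece (piece k V) (vertex k) j s ≃ₗ[k] rightPiece (piece k V) (vertex k) j s :=
  LinearEquiv.ofLinearMap (reverse.restrict fun _ => reverse_mem_rightPiece)
    (reverse.restrict fun _ => reverse_mem_leftPiece)
    (LinearMap.ext fun _ => Subtype.ext (reverse_reverse _))
    (LinearMap.ext fun _ => Subtype.ext (reverse_reverse _))

theorem finite_rightPiece (j : Quiver.Symmetrify V) (s : ℕ) :
    Module.Finite k (rightPiece (piece k V) (vertex k) j s) :=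
  Module.Finite.equiv (leftPieceEquiv j s)

theorem conjReverse_vertex {g : PreprojectiveAlgebra k V ≃ₐ[k] PreprojectiveAlgebra k V}
    (he : ∀ i : Quiver.Symmetrify V, g (vertex k i) = vertex k i) (i : Quiver.Symmetrify V) :
    conjReverse g (vertex k i) = vertex k i := by
  rw [conjReverse_apply, reverse_vertex, he, reverse_vertex]

/-- The anti-involution maps `A_s e_j` onto `e_j A_s` and intertwines the conjugate of `g` with `g`;
traces are invariant under conjugation. -/
theorem lowerVectorTrace_eq {g : PreprojectiveAlgebra k V ≃ₐ[k] PreprojectiveAlgebra k V}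
    (hg : IsGradedAut (piece k V) g)
    (he : ∀ i : Quiver.Symmetrify V, g (vertex k i) = vertex k i) :
    lowerVectorTrace hg he =
      upperVectorTrace (isGradedAut_conjReverse hg) (conjReverse_vertex he) := by
  funext j
  refine congrArg PowerSeries.mk (funext fun s => ?_)
  rw [← LinearMap.trace_conj' _ (leftPieceEquiv j s)]
  congr 1
  refine LinearMap.ext fun x => Subtype.ext ?_
  change g x = reverse (reverse (g (reverse (reverse x))))
  rw [reverse_reverse, reverse_reverse]

end Pieces

end PreprojectiveAlgebra

end

noncomputable section

/-! ### Arrows, trace matrix and additive function of the extended Dynkin quiver -/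

namespace DTilde

section Arrows

variable {R : Type*} [AddCommMonoid R]

/-- The sum of the values of `f` at the labels of the arrows from `a` to `b`. -/
def arrowSum (n : ℕ) (f : ℕ → R) (a b : ℕ) : R :=
  ∑ i ∈ Finset.Icc 1 n, if IsArrow n i a b then f i else 0

theorem sum_arrows {n : ℕ} (f : ℕ → R) (a b : DTilde n) :
    ∑ α : a ⟶ b, f (arrowLabel α) = arrowSum n f a.label b.label := by
  rw [arrowSum, ← Finset.sum_filter,
    ← Finset.sum_coe_sort ((Finset.Icc 1 n).filter fun i => IsArrow n i a.label b.label)]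
  refine Fintype.sum_equiv
    ⟨fun α => ⟨α.1.1, Finset.mem_filter.2 ⟨α.1.2, α.2⟩⟩,
      fun i => ⟨⟨i.1, (Finset.mem_filter.1 i.2).1⟩, (Finset.mem_filter.1 i.2).2⟩,
      fun _ => rfl, fun _ => rfl⟩ _ _ fun _ => rfl

/-- There are no parallel arrows, so the sum has a single term. -/
theorem arrowSum_eq {n : ℕ} (hn : 5 ≤ n) (f : ℕ → R) {a b i : ℕ} (h : IsArrow n i a b) :
    arrowSum n f a b = f i := by
  have hi : i ∈ Finset.Icc 1 n := by
    unfold IsArrow at h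
    rw [Finset.mem_Icc]
    omega
  rw [arrowSum, Finset.sum_eq_single_of_mem i hi, if_pos h]
  intro i' hi' hne
  rw [if_neg]
  unfold IsArrow at h ⊢
  omega

theorem arrowSum_eq_zero {n : ℕ} (f : ℕ → R) {a b : ℕ} (h : ∀ i, ¬ IsArrow n i a b) :
    arrowSum n f a b = 0 :=
  Finset.sum_eq_zero fun i _ => if_neg (h i)

end Arrows

/-- Replaces the nested cases by a form uniform in the arrows, valid also for `n = 5`, where the
vertices `3` and `n - 2` coincide. -/
theorem traceEntry_eq {k : Type*} [Field k] {n : ℕ} (hn : 5 ≤ n) (c t : ℕ → k) {i j : ℕ}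
    (hi : 1 ≤ i ∧ i ≤ n) (hj : 1 ≤ j ∧ j ≤ n) :
    traceEntry n c t i j =
      (if i = j then 1 + PowerSeries.C (c 1 * t 1) * PowerSeries.X ^ 2 else 0) -
      (arrowSum n (fun l => PowerSeries.C (c l) * PowerSeries.X) i j +
        arrowSum n (fun l => PowerSeries.C (t l) * PowerSeries.X) j i) := by
  -- No two arrows of the quiver are opposite, so only one of the two sums contributes.
  have key : ∀ (d : k⟦X⟧) (e : k⟦X⟧) (f f' : ℕ → k⟦X⟧) (i' j' l : ℕ), IsArrow n l i' j' →
      d = 0 → e = f l → -e = d - (arrowSum n f i' j' + arrowSum n f' j' i') := by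
    intro d e f f' i' j' l hl hd he
    rw [arrowSum_eq hn f hl, arrowSum_eq_zero f', hd, he]
    · simp
    · unfold IsArrow at hl ⊢
      omega
  unfold traceEntry
  split_ifs with h1 h2 h3 h4 h5 h6 h7
  · rw [arrowSum_eq_zero, arrowSum_eq_zero]
    · simp
    · unfold IsArrow; omega
    · unfold IsArrow; omega
  · exact key _ _ _ _ _ _ i (by unfold IsArrow; omega) rfl rfl
  · rw [add_comm]
    exact key _ _ _ _ _ _ j (by unfold IsArrow; omega) rfl rfl
  · exact key _ _ _ _ _ _ i (by unfold IsArrow; omega) rfl rfl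
  · rw [add_comm]
    exact key _ _ _ _ _ _ j (by unfold IsArrow; omega) rfl rfl
  · exact key _ _ _ _ _ _ j (by unfold IsArrow; omega) rfl rfl
  · rw [add_comm]
    exact key _ _ _ _ _ _ i (by unfold IsArrow; omega) rfl rfl
  · rw [arrowSum_eq_zero, arrowSum_eq_zero]
    · simp
    · unfold IsArrow; omega
    · unfold IsArrow; omega

theorem label_injective {n : ℕ} : Function.Injective (label : DTilde n → ℕ) :=
  Subtype.val_injective

theorem label_mem {n : ℕ} (v : DTilde n) : 1 ≤ v.label ∧ v.label ≤ n := Finset.mem_Icc.1 v.2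

section Matrix

variable {k : Type*} [Field k] {n : ℕ}

theorem transpose_traceMatrix (hn : 5 ≤ n) (c t : ℕ → k) :
    (traceMatrix n c t).transpose = traceMatrix n t c := by
  ext1 a b
  change traceEntry n c t b.label a.label = traceEntry n t c a.label b.label
  rw [traceEntry_eq hn _ _ (label_mem _) (label_mem _),
    traceEntry_eq hn _ _ (label_mem _) (label_mem _), mul_comm (c 1), add_comm (arrowSum _ _ _ _)]
  simp only [eq_comm]

/-- Modulo `X` the matrix is the identity, so its determinant has constant coefficient `1`. -/
theorem isUnit_traceMatrix (hn : 5 ≤ n) (c t : ℕ → k) : IsUnit (traceMatrix n c t) := by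
  rw [Matrix.isUnit_iff_isUnit_det, PowerSeries.isUnit_iff_constantCoeff, RingHom.map_det]
  have h : (PowerSeries.constantCoeff (R := k)).mapMatrix (traceMatrix n c t) = 1 := by
    ext a b
    change PowerSeries.constantCoeff (traceEntry n c t a.label b.label) = _
    have h0 : ∀ (f : ℕ → k) (i j : ℕ), PowerSeries.constantCoeff
        (arrowSum n (fun l => PowerSeries.C (f l) * PowerSeries.X) i j) = 0 := by
      intro f i j
      rw [arrowSum, map_sum]
      refine Finset.sum_eq_zero fun l _ => ?_
      split_ifs <;> simp
    rw [traceEntry_eq hn _ _ (label_mem _) (label_mem _), map_sub, map_add, h0, h0,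
      Matrix.one_apply]
    by_cases hab : a = b
    · simp [hab]
    · simp [hab, label_injective.eq_iff]
  rw [h, Matrix.det_one]
  exact isUnit_one

end Matrix

section AdditiveFunction

/-- The additive function: `1` at the four end points and `2` elsewhere. -/
def additive (n i : ℕ) : ℕ := if i = 1 ∨ i = 2 ∨ i = n - 1 ∨ i = n then 1 else 2

/-- Adjacency of vertices. -/
def Adj (n a b : ℕ) : Prop :=
  ((a = 1 ∨ a = 2) ∧ b = 3) ∨ ((b = 1 ∨ b = 2) ∧ a = 3) ∨
  ((3 ≤ a ∧ a ≤ n - 3) ∧ b = a + 1) ∨ ((3 ≤ b ∧ b ≤ n - 3) ∧ a = b + 1) ∨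
  (a = n - 2 ∧ (b = n - 1 ∨ b = n)) ∨ (b = n - 2 ∧ (a = n - 1 ∨ a = n))

instance (n a b : ℕ) : Decidable (Adj n a b) := by
  unfold Adj
  infer_instance

theorem exists_isArrow_of_adj {n a b : ℕ} (h : Adj n a b) :
    ∃ i, IsArrow n i a b ∨ IsArrow n i b a := by
  rcases h with h | h | h | h | h | h
  · exact ⟨a, Or.inl (Or.inl ⟨h.1, rfl, h.2⟩)⟩
  · exact ⟨b, Or.inr (Or.inl ⟨h.1, rfl, h.2⟩)⟩
  · exact ⟨a, Or.inl (Or.inr (Or.inl ⟨h.1, rfl, h.2⟩))⟩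
  · exact ⟨b, Or.inr (Or.inr (Or.inl ⟨h.1, rfl, h.2⟩))⟩
  · exact ⟨b, Or.inl (Or.inr (Or.inr ⟨h.2, h.1, rfl⟩))⟩
  · exact ⟨a, Or.inr (Or.inr (Or.inr ⟨h.2, h.1, rfl⟩))⟩

theorem arrowSum_one {n : ℕ} (hn : 5 ≤ n) (a b : ℕ) :
    arrowSum n (fun _ => 1) a b + arrowSum n (fun _ => 1) b a = if Adj n a b then 1 else 0 := by
  have h0 : ∀ {a b i : ℕ}, IsArrow n i a b →
      arrowSum n (fun _ => 1) a b + arrowSum n (fun _ => 1) b a = 1 := by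
    intro a b i hi
    have hz : ∀ i, ¬ IsArrow n i b a := by
      unfold IsArrow at hi ⊢
      omega
    rw [arrowSum_eq hn _ hi, arrowSum_eq_zero _ hz, add_zero]
  split_ifs with h
  · obtain ⟨i, hi | hi⟩ := exists_isArrow_of_adj h
    · exact h0 hi
    · rw [add_comm]
      exact h0 hi
  · have hz : (∀ i, ¬ IsArrow n i a b) ∧ ∀ i, ¬ IsArrow n i b a := by
      unfold IsArrow
      unfold Adj at h
      constructor <;> omega
    rw [arrowSum_eq_zero _ hz.1, arrowSum_eq_zero _ hz.2, add_zero]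

/-- Up to the choice of basis, `additive` is the minimal null root of the affine diagram; the check
goes through the neighbourhoods of the vertices. -/
theorem sum_additive {n : ℕ} (hn : 5 ≤ n) {a : ℕ} (ha : 1 ≤ a ∧ a ≤ n) :
    ∑ b ∈ Finset.Icc 1 n, (if Adj n a b then additive n b else 0) = 2 * additive n a := by
  rw [← Finset.sum_filter]
  by_cases h1 : a = 1 ∨ a = 2
  · have : (Finset.Icc 1 n).filter (Adj n a) = {3} := by
      ext b
      simp only [Finset.mem_filter, Finset.mem_Icc, Finset.mem_singleton, Adj]
      omega
    rw [this, Finset.sum_singleton]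
    unfold additive
    split_ifs <;> omega
  by_cases h2 : a = n - 1 ∨ a = n
  · have : (Finset.Icc 1 n).filter (Adj n a) = {n - 2} := by
      ext b
      simp only [Finset.mem_filter, Finset.mem_Icc, Finset.mem_singleton, Adj]
      omega
    rw [this, Finset.sum_singleton]
    unfold additive
    split_ifs <;> omega
  by_cases h3 : a = 3
  -- For `n = 5` the vertex `3` is also `n - 2` and has four neighbours, all of them end points.
  · by_cases h5 : n = 5
    · have : (Finset.Icc 1 n).filter (Adj n a) = {1, 2, 4, 5} := by
        ext b
        simp only [Finset.mem_filter, Finset.mem_Icc, Finset.mem_singleton, Finset.mem_insert, Adj]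
        omega
      subst h3 h5
      rw [this]
      rfl
    · have : (Finset.Icc 1 n).filter (Adj n a) = {1, 2, 4} := by
        ext b
        simp only [Finset.mem_filter, Finset.mem_Icc, Finset.mem_singleton, Finset.mem_insert, Adj]
        omega
      rw [this, Finset.sum_insert (by simp), Finset.sum_insert (by simp), Finset.sum_singleton]
      unfold additive
      split_ifs <;> omega
  by_cases h4 : a = n - 2
  · have : (Finset.Icc 1 n).filter (Adj n a) = {n - 3, n - 1, n} := by
      ext b
      simp only [Finset.mem_filter, Finset.mem_Icc, Finset.mem_singleton, Finset.mem_insert, Adj]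
      omega
    rw [this, Finset.sum_insert (by simp only [Finset.mem_insert, Finset.mem_singleton]; omega),
      Finset.sum_insert (by rw [Finset.mem_singleton]; omega),
      Finset.sum_singleton]
    unfold additive
    split_ifs <;> omega
  · have : (Finset.Icc 1 n).filter (Adj n a) = {a - 1, a + 1} := by
      ext b
      simp only [Finset.mem_filter, Finset.mem_Icc, Finset.mem_singleton, Finset.mem_insert, Adj]
      omega
    rw [this, Finset.sum_insert (by rw [Finset.mem_singleton]; omega), Finset.sum_singleton]
    unfold additive
    split_ifs <;> omega

theorem card_hom {n : ℕ} (hn : 5 ≤ n) (a b : Quiver.Symmetrify (DTilde n)) :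
    Fintype.card (a ⟶ b) =
      if Adj n (label (n := n) a) (label (n := n) b) then 1 else 0 := by
  have h : ∀ a b : DTilde n, Fintype.card (a ⟶ b) = arrowSum n (fun _ => 1) a.label b.label := by
    intro a b
    rw [← sum_arrows]
    simp
  rw [← arrowSum_one hn]
  let I : ∀ a b : DTilde n, Fintype (a ⟶ b) := inferInstance
  exact (@Fintype.card_sum _ _ (I a b) (I b a)).trans (congrArg₂ _ (h a b) (h b a))

theorem sum_card_hom_mul_additive {n : ℕ} (hn : 5 ≤ n) (a : Quiver.Symmetrify (DTilde n)) :
    ∑ b : Quiver.Symmetrify (DTilde n), Fintype.card (a ⟶ b) * additive n (label (n := n) b) =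
      2 * additive n (label (n := n) a) := by
  rw [← sum_additive hn (label_mem (n := n) a), ← Finset.sum_coe_sort (Finset.Icc 1 n)]
  refine Finset.sum_congr rfl fun b _ => ?_
  rw [card_hom hn, ite_mul, one_mul, zero_mul]
  rfl

theorem additive_pos (n i : ℕ) : 0 < additive n i := by
  unfold additive
  split_ifs <;> decide

end AdditiveFunction

/-! ### The linear system for the vector trace -/

section Main

variable {k : Type*} [Field k] {n : ℕ}

/-- The scalar by which an arrow of the double is multiplied. -/
def scalar (c t : ℕ → k) {a b : Quiver.Symmetrify (DTilde n)} (β : a ⟶ b) : k :=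
  Sum.elim (fun α => c (arrowLabel (n := n) α)) (fun α => t (arrowLabel (n := n) α)) β

theorem sum_scalar (c t : ℕ → k) (a b : Quiver.Symmetrify (DTilde n)) :
    ∑ β : a ⟶ b, PowerSeries.C (scalar c t β) * PowerSeries.X =
      arrowSum n (fun l => PowerSeries.C (c l) * PowerSeries.X) (label (n := n) a)
        (label (n := n) b) +
      arrowSum n (fun l => PowerSeries.C (t l) * PowerSeries.X) (label (n := n) b)
        (label (n := n) a) := by
  let I : ∀ a b : DTilde n, Fintype (a ⟶ b) := inferInstance
  exact (@Fintype.sum_sum_type _ _ _ (I a b) (I b a) _ _).trans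
    (congrArg₂ _ (sum_arrows (n := n) (fun l => PowerSeries.C (c l) * PowerSeries.X) a b)
      (sum_arrows (n := n) (fun l => PowerSeries.C (t l) * PowerSeries.X) b a))

variable {g : PreprojectiveAlgebra k (DTilde n) ≃ₐ[k] PreprojectiveAlgebra k (DTilde n)}

open PreprojectiveAlgebra

/-- The product of the scalars of an arrow and its reverse does not depend on the arrow. -/
theorem scalar_mul_scalar_reverse (hn : 5 ≤ n) {c t : ℕ → k}
    (hγ : ∀ {h j : Quiver.Symmetrify (DTilde n)} (β : h ⟶ j),
      g (ofHom k β) = scalar c t β • ofHom k β)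
    {h j : Quiver.Symmetrify (DTilde n)} (β : h ⟶ j) :
    scalar c t β * scalar c t (Quiver.reverse β) = c 1 * t 1 := by
  choose μ hμ using exists_mul_reverse_eq (γ := fun {h j} (β : h ⟶ j) => scalar c t β) hγ
  -- So far `μ` depends on the vertex. An arrow and its star give the same product at both ends, so
  -- `μ` is constant along edges, hence everywhere by connectedness.
  have harrow : ∀ (a b : DTilde n) (i : ℕ), IsArrow n i a.label b.label →
      c i * t i = μ a ∧ c i * t i = μ b := by
    intro a b i hi
    have hmem : i ∈ Finset.Icc 1 n := by
      have := label_mem a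
      have := label_mem b
      unfold IsArrow at hi
      rw [Finset.mem_Icc]
      omega
    let α : a ⟶ b := ⟨⟨i, hmem⟩, hi⟩
    constructor
    · rw [mul_comm]
      exact hμ a b (Sum.inr α)
    · exact hμ b a (Sum.inl α)
  have hadj : ∀ a b : DTilde n, Adj n a.label b.label → μ a = μ b := by
    intro a b hab
    obtain ⟨i, hi | hi⟩ := exists_isArrow_of_adj hab
    · exact (harrow a b i hi).1.symm.trans (harrow a b i hi).2
    · exact (harrow b a i hi).2.symm.trans (harrow b a i hi).1
  let v : ∀ i, 1 ≤ i ∧ i ≤ n → DTilde n := fun i hi => ⟨i, Finset.mem_Icc.2 hi⟩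
  have h3 : μ (v 3 (by omega)) = c 1 * t 1 :=
    ((harrow (v 1 (by omega)) (v 3 (by omega)) 1 (Or.inl ⟨Or.inl rfl, rfl, rfl⟩)).2).symm
  have hinner : ∀ i, 3 ≤ i → ∀ hi : 1 ≤ i ∧ i ≤ n, i ≤ n - 2 → μ (v i hi) = c 1 * t 1 := by
    intro i h3i
    induction i, h3i using Nat.le_induction with
    | base => exact fun _ _ => h3
    | succ i h3i ih =>
      intro hi hi'
      rw [← ih (by omega) (by omega)]
      refine hadj _ _ ?_
      change Adj n (i + 1) i
      unfold Adj
      omega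
  have hall : ∀ w : DTilde n, μ w = c 1 * t 1 := by
    intro w
    have hw := label_mem w
    by_cases h1 : w.label = 1 ∨ w.label = 2
    · rw [← h3]
      refine hadj _ _ ?_
      change Adj n w.label 3
      unfold Adj
      omega
    by_cases h2 : w.label = n - 1 ∨ w.label = n
    · rw [← hinner (n - 2) (by omega) (by omega) le_rfl]
      refine hadj _ _ ?_
      change Adj n w.label (n - 2)
      unfold Adj
      omega
    · exact hinner w.label (by omega) hw (by omega)
  exact (hμ j h β).trans (hall j)

theorem upperVectorTrace_eq_mulVec (hn : 5 ≤ n) (hg : IsGradedAut (piece k (DTilde n)) g)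
    (he : ∀ v : Quiver.Symmetrify (DTilde n), g (vertex k v) = vertex k v) {c t : ℕ → k}
    (hγ : ∀ {h j : Quiver.Symmetrify (DTilde n)} (β : h ⟶ j),
      g (ofHom k β) = scalar c t β • ofHom k β) :
    (upperVectorTrace hg he : DTilde n → k⟦X⟧) =
      (traceMatrix n t c)⁻¹.mulVec (fun _ => 1) := by
  let T : DTilde n → k⟦X⟧ := upperVectorTrace hg he
  change T = _
  have h1 : (traceMatrix n t c).mulVec T = fun _ => 1 := by
    funext j
    -- The entry in row `j` and column `h` collects the arrows `h → j` of the double: `α : h → j`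
    -- with scalar `c`, and `α*` for `α : j → h` with scalar `t`. Hence the matrix is the one with
    -- `t` before `c`.
    let S : DTilde n → DTilde n → k⟦X⟧ := fun j h => arrowSum n
        (fun l => PowerSeries.C (t l) * PowerSeries.X) j.label h.label +
      arrowSum n (fun l => PowerSeries.C (c l) * PowerSeries.X) h.label j.label
    have hS : ∀ h j : Quiver.Symmetrify (DTilde n),
        ∑ β : h ⟶ j, PowerSeries.C (scalar c t β) * PowerSeries.X = S j h := by
      intro h j
      rw [sum_scalar, add_comm]
    have h2 : ∀ h : DTilde n, traceMatrix n t c j h =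
        (if j = h then 1 + PowerSeries.C (c 1 * t 1) * PowerSeries.X ^ 2 else 0) - S j h := by
      intro h
      rw [mul_comm (c 1)]
      refine (traceEntry_eq hn t c (label_mem j) (label_mem h)).trans ?_
      simp only [label_injective.eq_iff, S]
    have h3 : (1 + PowerSeries.C (c 1 * t 1) * PowerSeries.X ^ 2) * T j -
        ∑ h : DTilde n, S j h * T h = 1 := by
      refine Eq.trans ?_ (PreprojectiveAlgebra.upperVectorTrace_eq hg he
        (sum_card_hom_mul_additive hn) (fun _ => additive_pos _ _)
        (γ := fun {h j} (β : h ⟶ j) => scalar c t β) hγ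
        (scalar_mul_scalar_reverse hn hγ) j)
      exact congrArg₂ _ rfl (Finset.sum_congr rfl fun h _ => congrArg₂ _ (hS h j).symm rfl)
    rw [← h3]
    simp only [Matrix.mulVec, dotProduct, h2, sub_mul, Finset.sum_sub_distrib, ite_mul, zero_mul,
      Finset.sum_ite_eq, Finset.mem_univ, if_true]
  rw [← h1, Matrix.mulVec_mulVec, Matrix.nonsing_inv_mul, Matrix.one_mulVec]
  exact (Matrix.isUnit_iff_isUnit_det _).1 (isUnit_traceMatrix hn t c)

end Main

end DTilde

end

theorem proposition4p6 {k : Type*} [Field k] [IsAlgClosed k] [CharZero k]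
    (n : ℕ) (hn : 5 ≤ n)
    (g : PreprojectiveAlgebra k (DTilde n) ≃ₐ[k] PreprojectiveAlgebra k (DTilde n))
    (hg : IsGradedAut (PreprojectiveAlgebra.piece k (DTilde n)) g)
    (he : ∀ v : DTilde n, g (PreprojectiveAlgebra.idem k v) = PreprojectiveAlgebra.idem k v)
    (c t : ℕ → k)
    (hc : ∀ (a b : DTilde n) (α : a ⟶ b), g (PreprojectiveAlgebra.arrow k α) =
      c (DTilde.arrowLabel α) • PreprojectiveAlgebra.arrow k α)
    (ht : ∀ (a b : DTilde n) (α : a ⟶ b), g (PreprojectiveAlgebra.arrowStar k α) =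
      t (DTilde.arrowLabel α) • PreprojectiveAlgebra.arrowStar k α) :
    -- all the traces that occur are traces on finite-dimensional spaces
    (∀ (v : DTilde n) (s : ℕ),
      FiniteDimensional k (rightPiece (PreprojectiveAlgebra.piece k (DTilde n))
        (PreprojectiveAlgebra.idem k) v s) ∧
      FiniteDimensional k (leftPiece (PreprojectiveAlgebra.piece k (DTilde n))
        (PreprojectiveAlgebra.idem k) v s)) ∧
    IsUnit (DTilde.traceMatrix n c t) ∧
    IsUnit (DTilde.traceMatrix n t c) ∧
    lowerVectorTrace hg he = (DTilde.traceMatrix n c t)⁻¹.mulVec (fun _ => 1) ∧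
    upperVectorTrace hg he = (DTilde.traceMatrix n t c)⁻¹.mulVec (fun _ => 1) ∧
    (DTilde.traceMatrix n c t).transpose = DTilde.traceMatrix n t c := by
  have hγ : ∀ {h j : Quiver.Symmetrify (DTilde n)} (β : h ⟶ j),
      g (PreprojectiveAlgebra.ofHom k β) =
        DTilde.scalar c t β • PreprojectiveAlgebra.ofHom k β := by
    intro h j β
    rcases β with α | α
    · exact hc h j α
    · exact ht j h α
  -- The conjugate of `g` scales `α` by `t` and `α*` by `c`, so the formula for its upper trace has
  -- the two families exchanged.
  have hγ' : ∀ {h j : Quiver.Symmetrify (DTilde n)} (β : h ⟶ j),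
      PreprojectiveAlgebra.conjReverse g (PreprojectiveAlgebra.ofHom k β) =
        DTilde.scalar t c β • PreprojectiveAlgebra.ofHom k β := by
    intro h j β
    rw [PreprojectiveAlgebra.conjReverse_apply, PreprojectiveAlgebra.reverse_ofHom, hγ, map_smul,
      PreprojectiveAlgebra.reverse_ofHom, Quiver.reverse_reverse]
    rcases β with α | α <;> rfl
  refine ⟨fun v s => ⟨PreprojectiveAlgebra.finite_rightPiece (V := DTilde n) v s,
    PreprojectiveAlgebra.finite_leftPiece (V := DTilde n) v s⟩,
    DTilde.isUnit_traceMatrix hn c t, DTilde.isUnit_traceMatrix hn t c, ?_,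
    DTilde.upperVectorTrace_eq_mulVec hn hg he hγ, DTilde.transpose_traceMatrix hn c t⟩
  exact (PreprojectiveAlgebra.lowerVectorTrace_eq hg he).trans
    (DTilde.upperVectorTrace_eq_mulVec hn (PreprojectiveAlgebra.isGradedAut_conjReverse hg)
      (PreprojectiveAlgebra.conjReverse_vertex he) hγ')
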